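/- **Conventions.** For a group $G$ and $n\ge 0$ let $BG_n=\{[g_1,\dots,g_n]: g_i\in G\}$ be the set of $n$-simplices of the simplicial classifying space $BG$. Its faces $d_i$ ($0\le i\le n$) drop $g_1$ for $i=0$, drop $g_n$ for $i=n$, and multiply $g_i$ and $g_{i+1}$ for $0<i<n$. Its degeneracies are $s_i[g_1,\dots,g_n]=[g_1,\dots,g_i,e,g_{i+1},\dots,g_n]$. The Moore complex $\mathbb ZBG_*$ has in degree $n$ the free abelian group on $BG_n$, and boundary $\partial=\sum_i(-1)^id_i$. Homomorphisms $f,g\colon G\to H$ *commute* if $f(x)g(y)=g(y)f(x)$ for all $x,y\in G$. The *edgewise subdivision* $Ed_{(f,g)}\colon\mathbb ZBG_*\to\mathbb ZBH_*$ is the composite $$\mathbb ZBG_*\xrightarrow{D_*}\mathbb Z(BG\times BG)_*\xrightarrow{(g,f)_*}\mathbb Z(BH\times BH)_*\xrightarrow{\Delta}\mathbb ZBH_*\otimes\mathbb ZBH_*\xrightarrow{\nabla}\mathbb Z(BH\times BH)_*\xrightarrow{T_*}\mathbb ZBH_*$$ of the diagonal, the map induced by $(x,y)\mapsto(g(x),f(y))$,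 the Alexander–Whitney map $\Delta$, the Eilenberg–Zilber shuffle map $\nabla$, and the map that multiplies two simplices component by component. A $(p,q)$-shuffle, $p+q=n$, is a permutation $\pi$ of $\{1,\dots,n\}$ that is increasing on $\{1,\dots,p\}$ and on $\{p+1,\dots,n\}$; $S_{p,q}$ is the set of these. For $\sigma=[g_1,\dots,g_n]$ let $\pi_{(f,g)}\sigma\in BH_n$ be the simplex whose $\pi(j)$-th component is $g(g_j)$ for $j\le p$ and $f(g_j)$ for $j>p$. For $a=[a_1,\dots,a_n]$, $b=[b_1,\dots,b_n]$ and $T=(t_0,\dots,t_n)$ with $t_ra_{r+1}=b_{r+1}t_{r+1}$ for $0\le r<n$, the *simplicial cylinder* is $$Cyl(a,b,T)=\sum_{r=0}^n(-1)^r[b_1,\dots,b_r,t_r,a_{r+1},\dots,a_n].$$ The diameter $d(u)$ of a chain is the sum of the absolute values of its coefficients, and the diameter function of a chain homotopy $P$ is $d_P(n)=\sup\{d(P(\sigma)):\sigma\in BG_i,\ i\le n\}$. **Theorem.** (1) Let $G,H$ be groups and $f,g,h,k\colon G\to H$ homomorphisms such that $f$ and $g$ commute and $h$ and $k$ commute.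 Suppose that $\ell\in H$ satisfies $\ell f(x)g(x)=h(x)k(x)\ell$ for all $x\in G$. Then $Ed_{(f,g)}$ and $Ed_{(h,k)}$ are chain maps, and they are chain homotopic. Explicitly, put $m(x)=h(x)^{-1}\ell f(x)$. For $\pi\in S_{p,q}$, $p+q=n$, and $\sigma=[g_1,\dots,g_n]$, let $T_\pi(\sigma)=(t_0,\dots,t_n)$ with $t_r=m(g_{a+1}g_{a+2}\cdots g_{p+c})$, where $a=\#\{j\le p:\pi(j)\le r\}$ and $c=\#\{j>p:\pi(j)\le r\}$. Then $$Ed_{(f,g)}(\sigma)=\sum_{p+q=n}\ \sum_{\pi\in S_{p,q}}\operatorname{sign}(\pi)\,\pi_{(f,g)}\sigma ,$$ likewise for $(h,k)$, and $T_\pi(\sigma)$ satisfies the relations required for a simplicial cylinder between $\pi_{(f,g)}\sigma$ and $\pi_{(h,k)}\sigma$. Moreover, with either of the two choices $P([\ ])=0$ or $P([\ ])=[\ell]$ in degree $0$, the formula $$P(\sigma)=\sum_{p+q=n}\ \sum_{\pi\in S_{p,q}}\operatorname{sign}(\pi)\,Cyl\bigl(\pi_{(f,g)}\sigma,\ \pi_{(h,k)}\sigma,\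 T_\pi(\sigma)\bigr)\qquad(n\ge1)$$ defines a chain homotopy, $\partial P+P\partial=Ed_{(f,g)}-Ed_{(h,k)}$. The value $P(\sigma)$ is a signed sum of exactly $2^n(n+1)$ simplices, counted before cancellation. The diameter function satisfies $d_P(0)=0$ for the choice $P([\ ])=0$ and $d_P(0)=1=2^0(0+1)$ for the choice $P([\ ])=[\ell]$. For every $n\ge1$: * $d_P(n)\le 2^n(n+1)$; * $d_P(n)=2^n(n+1)$ if and only if there is an $n$-simplex $\sigma$ for which no two of the $2^n(n+1)$ simplices occurring in $P(\sigma)$ with opposite signs coincide; * in particular $d_P(n)=2^n(n+1)$ whenever some $x\in G$ satisfies $f(x)\ne g(x)$, $h(x)\ne k(x)$ and $m(x^j)\notin\{h(x),k(x)\}$ for $0\le j\le n$. (2) The bound is exact: there are $G,H,f,g,h,k,\ell$ as in (1) for which $d_P(n)=2^n(n+1)$ for all $n\ge1$, for both choices of $P([\ ])$. -/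

import Mathlib

open CategoryTheory TensorProduct

universe u

noncomputable section

namespace EdgewiseHomotopy

/-- The `n`-simplices `[g₁, …, gₙ]` of the simplicial classifying space `BG`.
Components are indexed from `0`: `σ i` is `g_{i+1}`. -/
abbrev BSimplex (G : Type u) (n : ℕ) : Type u := Fin n → G

/-- The free abelian group on a set `X`. -/
abbrev Chains (X : Type u) : Type u := X →₀ ℤ

/-- The face function `d_i`, `0 ≤ i ≤ n + 1`, on the `(n+1)`-simplices of `BG`: it drops `g₁` if
`i = 0`, drops the last component if `i = n + 1`, and otherwise multiplies `g_i` and `g_{i+1}`. -/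
def face {G : Type u} [Group G] {n : ℕ} (i : Fin (n + 2)) (σ : BSimplex G (n + 1)) :
    BSimplex G n :=
  fun c => if (c : ℕ) + 1 < i then σ c.castSucc
    else if (c : ℕ) + 1 = i then σ c.castSucc * σ c.succ
    else σ c.succ

/-- The degeneracy function `s_i [g₁, …, gₙ] = [g₁, …, g_i, e, g_{i+1}, …, gₙ]`. -/
def degen {G : Type u} [Group G] {n : ℕ} (i : Fin (n + 1)) (σ : BSimplex G n) :
    BSimplex G (n + 1) :=
  Fin.insertNth (α := fun _ => G) i 1 σ

/-- The boundary operator `∂ = ∑ (-1)^i d_i` of the Moore complex of `BG`. -/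
def boundary (G : Type u) [Group G] (n : ℕ) :
    Chains (BSimplex G (n + 1)) →ₗ[ℤ] Chains (BSimplex G n) :=
  ∑ i : Fin (n + 2), (-1 : ℤ) ^ (i : ℕ) • Finsupp.lmapDomain ℤ ℤ (face i)

theorem face_face {G : Type u} [Group G] {n : ℕ} {i j : Fin (n + 2)} (hij : i ≤ j)
    (σ : BSimplex G (n + 2)) :
    face i (face j.succ σ) = face j (face i.castSucc σ) := by
  funext c
  have hij' : (i : ℕ) ≤ j := hij
  simp only [face, Fin.val_succ, Fin.val_castSucc, Fin.succ_castSucc]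
  split_ifs <;> first | rfl | omega | simp [mul_assoc]

theorem boundary_comp_boundary (G : Type u) [Group G] (n : ℕ) :
    boundary G n ∘ₗ boundary G (n + 1) = 0 := by
  refine Finsupp.lhom_ext' fun σ => LinearMap.ext_ring ?_
  simp only [boundary, LinearMap.comp_apply, LinearMap.sum_apply, LinearMap.smul_apply,
    Finsupp.lsingle_apply, Finsupp.lmapDomain_apply, Finsupp.mapDomain_single, map_sum, map_smul,
    LinearMap.zero_apply, Finset.smul_sum, smul_smul]
  rw [← Finset.sum_product', Finset.univ_product_univ]
  let S : Finset (Fin (n + 3) × Fin (n + 2)) := {x | (x.1 : ℕ) ≤ (x.2 : ℕ)}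
  rw [← Finset.sum_add_sum_compl S, ← eq_neg_iff_add_eq_zero, ← Finset.sum_neg_distrib]
  refine Finset.sum_bij
    (fun x hx => (x.2.succ, x.1.castLT
      (lt_of_le_of_lt (Finset.mem_filter.mp hx).right x.2.isLt))) ?_ ?_ ?_ ?_
  · intro x hx
    simp only [S, Finset.compl_filter, Finset.mem_filter_univ, Fin.val_succ,
      Fin.val_castLT] at hx ⊢
    omega
  · rintro ⟨j, i⟩ hx ⟨j', i'⟩ hx' h
    simp only [Prod.mk.injEq, Fin.ext_iff, Fin.val_succ, Fin.val_castLT] at h ⊢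
    omega
  · rintro ⟨j, i⟩ hx
    simp only [S, Finset.compl_filter, Finset.mem_filter_univ, not_le] at hx
    refine ⟨(i.castSucc, j.pred ?_), ?_, ?_⟩
    · rintro rfl
      simp at hx
    · simp only [S, Finset.mem_filter_univ, Fin.val_castSucc, Fin.val_pred]
      omega
    · simp
  · rintro ⟨j, i⟩ hx
    simp only [S, Finset.mem_filter_univ] at hx
    have hj : (j : ℕ) < n + 2 := lt_of_le_of_lt hx i.isLt
    have key := face_face (i := j.castLT hj) (j := i) hx σ
    rw [Fin.castSucc_castLT] at key
    simp only [Fin.val_succ, Fin.val_castLT, key, ← neg_smul]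
    congr 1
    rw [pow_succ]; ring

/-- The Moore complex `ℤBG_*` of the simplicial classifying space `BG`. -/
def moore (G : Type u) [Group G] : ChainComplex (ModuleCat.{u} ℤ) ℕ :=
  ChainComplex.of (fun n => ModuleCat.of ℤ (Chains (BSimplex G n)))
    (fun n => ModuleCat.ofHom (boundary G n)) (fun n => by
      rw [← ModuleCat.ofHom_comp, boundary_comp_boundary]; rfl)

/-! ### The edgewise subdivision -/

/-- The iterated degeneracy `s_{ν_q} ⋯ s_{ν_1} σ` of a `p`-simplex `σ`. It is only used for
increasing sequences `ν_1 < ⋯ < ν_q` in `{0, …, p + q - 1}`, for which all indices are in range. -/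
def iterDegen {H : Type u} [Group H] {p : ℕ} :
    (q : ℕ) → (Fin q → ℕ) → BSimplex H p → BSimplex H (p + q)
  | 0, _, σ => σ
  | q + 1, ν, σ => degen (Fin.ofNat (p + q + 1) (ν (Fin.last q)))
      (iterDegen q (fun j => ν j.castSucc) σ)

/-- The front face `d_{p+1} ⋯ d_{p+q} σ` of a `(p+q)`-simplex `σ`. -/
def frontFace {H : Type u} [Group H] {p : ℕ} : (q : ℕ) → BSimplex H (p + q) → BSimplex H p
  | 0, σ => σ
  | q + 1, σ => frontFace q (face (Fin.last (p + q + 1)) σ)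

/-- The back face `(d_0)^p σ` of a `(q+p)`-simplex `σ`. -/
def backFace {H : Type u} [Group H] {q : ℕ} : (p : ℕ) → BSimplex H (q + p) → BSimplex H q
  | 0, σ => σ
  | p + 1, σ => backFace p (face 0 σ)

/-- A simplex of dimension `m`, regarded as one of dimension `n = m`. -/
def recast {H : Type u} {m n : ℕ} (e : m = n) (σ : BSimplex H m) : BSimplex H n :=
  fun i => σ (Fin.cast e.symm i)

/-- For `p ≤ n`, the set of `(p, n - p)`-shuffles: the permutations `π` of `{0, …, n - 1}` that are
increasing on `{0, …, p - 1}` and on `{p, …, n - 1}`. -/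
def shuffles (n p : ℕ) : Finset (Equiv.Perm (Fin n)) :=
  {π | ∀ i j : Fin n, i < j → ((j : ℕ) < p ∨ p ≤ (i : ℕ)) → π i < π j}

/-- Degree `n` of the tensor product `ℤBH_* ⊗ ℤBH_*`. -/
abbrev TensorDegree (H : Type u) (n : ℕ) : Type u :=
  DirectSum (Finset.HasAntidiagonal.antidiagonal n)
    (fun x => Chains (BSimplex H x.1.1) ⊗[ℤ] Chains (BSimplex H x.1.2))

/-- `D_*`, induced by the diagonal map. -/
def diagonalMap (G : Type u) (n : ℕ) :
    Chains (BSimplex G n) →ₗ[ℤ] Chains (BSimplex G n × BSimplex G n) :=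
  Finsupp.lmapDomain ℤ ℤ (fun σ => (σ, σ))

/-- `(g, f)_*`, induced by `(x, y) ↦ (g x, f y)`. -/
def pairMap {G H : Type u} [Group G] [Group H] (g f : G →* H) (n : ℕ) :
    Chains (BSimplex G n × BSimplex G n) →ₗ[ℤ] Chains (BSimplex H n × BSimplex H n) :=
  Finsupp.lmapDomain ℤ ℤ (fun x => (fun i => g (x.1 i), fun i => f (x.2 i)))

/-- The Alexander–Whitney map
`σ × τ ↦ ∑_{p + q = n} d_{p+1} ⋯ d_n σ ⊗ (d_0)^p τ`. -/
def alexanderWhitney (H : Type u) [Group H] (n : ℕ) :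
    Chains (BSimplex H n × BSimplex H n) →ₗ[ℤ] TensorDegree H n :=
  Finsupp.linearCombination ℤ fun x =>
    ∑ pq : Finset.HasAntidiagonal.antidiagonal n,
      DirectSum.lof ℤ (Finset.HasAntidiagonal.antidiagonal n)
        (fun x => Chains (BSimplex H x.1.1) ⊗[ℤ] Chains (BSimplex H x.1.2)) pq
        (Finsupp.single (frontFace pq.1.2
            (recast (Finset.HasAntidiagonal.mem_antidiagonal.mp pq.2).symm x.1)) 1 ⊗ₜ[ℤ]
          Finsupp.single (backFace pq.1.1
            (recast ((Nat.add_comm _ _).trans (Finset.HasAntidiagonal.mem_antidiagonal.mp pq.2)).symm x.2)) 1)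

/-- For `p + q = n` and a `(p, q)`-shuffle `π = (μ, ν)`, where `μ_{i+1} = π i` for `i < p` and
`ν_{j+1} = π (p + j)` for `j < q`: the simplex
`(s_{ν_q} ⋯ s_{ν_1} σ) × (s_{μ_p} ⋯ s_{μ_1} τ)` of `BH × BH`. -/
def shuffleProduct {H : Type u} [Group H] {n p q : ℕ} (e : p + q = n) (π : Equiv.Perm (Fin n))
    (σ : BSimplex H p) (τ : BSimplex H q) : BSimplex H n × BSimplex H n :=
  (recast e (iterDegen q (fun j => (π ⟨p + j, by omega⟩).val) σ),
    recast ((Nat.add_comm q p).trans e) (iterDegen p (fun i => (π ⟨i, by omega⟩).val) τ))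

/-- The Eilenberg–Zilber shuffle map
`σ ⊗ τ ↦ ∑_{(μ, ν)} ε(μ, ν) (s_{ν_q} ⋯ s_{ν_1} σ) × (s_{μ_p} ⋯ s_{μ_1} τ)`. -/
def eilenbergZilber (H : Type u) [Group H] (n : ℕ) :
    TensorDegree H n →ₗ[ℤ] Chains (BSimplex H n × BSimplex H n) :=
  DirectSum.toModule ℤ (Finset.HasAntidiagonal.antidiagonal n) _ fun pq =>
    (Finsupp.linearCombination ℤ fun x : BSimplex H pq.1.1 × BSimplex H pq.1.2 =>
      ∑ π ∈ shuffles n pq.1.1, (Equiv.Perm.sign π : ℤ) •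
        Finsupp.single (shuffleProduct (Finset.HasAntidiagonal.mem_antidiagonal.mp pq.2) π x.1 x.2) (1 : ℤ)) ∘ₗ
      (finsuppTensorFinsupp' ℤ (BSimplex H pq.1.1) (BSimplex H pq.1.2)).toLinearMap

/-- `T_*`, induced by `(x, y) ↦ x y`. -/
def multMap (H : Type u) [Group H] (n : ℕ) :
    Chains (BSimplex H n × BSimplex H n) →ₗ[ℤ] Chains (BSimplex H n) :=
  Finsupp.lmapDomain ℤ ℤ (fun x i => x.1 i * x.2 i)

/-- The edgewise subdivision `Ed_{(f,g)}` in degree `n`, the composite of `D_*`, `(g, f)_*`, the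
Alexander–Whitney map, the shuffle map and `T_*`. -/
def edgewise {G H : Type u} [Group G] [Group H] (f g : G →* H) (n : ℕ) :
    Chains (BSimplex G n) →ₗ[ℤ] Chains (BSimplex H n) :=
  multMap H n ∘ₗ eilenbergZilber H n ∘ₗ alexanderWhitney H n ∘ₗ pairMap g f n ∘ₗ diagonalMap G n

/-- `f` and `g` commute: `f x` and `g y` commute for all `x`, `y`. -/
def HomsCommute {G H : Type u} [Group G] [Group H] (f g : G →* H) : Prop :=
  ∀ x y : G, f x * g y = g y * f x

/-! ### Simplicial cylinders and the homotopy -/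

/-- The simplex `[b₁, …, b_r, t_r, a_{r+1}, …, a_n]`. -/
def cylinderSimplex {H : Type u} {n : ℕ} (a b : BSimplex H n) (t : Fin (n + 1) → H)
    (r : Fin (n + 1)) : BSimplex H (n + 1) :=
  Fin.insertNth (α := fun _ => H) r (t r) (fun j => if j.castSucc < r then b j else a j)

/-- The simplicial cylinder `∑_r (-1)^r [b₁, …, b_r, t_r, a_{r+1}, …, a_n]`. -/
def cylinder {H : Type u} {n : ℕ} (a b : BSimplex H n) (t : Fin (n + 1) → H) :
    Chains (BSimplex H (n + 1)) :=
  ∑ r : Fin (n + 1), (-1 : ℤ) ^ (r : ℕ) • Finsupp.single (cylinderSimplex a b t r) 1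

/-- The relations `t_r a_{r+1} = b_{r+1} t_{r+1}`, under which the simplicial cylinder between
`[a₁, …, a_n]` and `[b₁, …, b_n]` related by `t₀, …, t_n` is considered. -/
def IsPillars {H : Type u} [Group H] {n : ℕ} (a b : BSimplex H n) (t : Fin (n + 1) → H) : Prop :=
  ∀ r : Fin n, t r.castSucc * a r = b r * t r.succ

/-- For a `(p, n - p)`-shuffle `π` and `σ = [g₁, …, gₙ]`, the simplex with entries `g(g_j)`, `j ≤ p`,
and `f(g_j)`, `j > p`, in which the entry with `g_j` stands at the `π(j)`-th place. -/
def shuffleSimplex {G H : Type u} [Group G] [Group H] (f g : G →* H) {n : ℕ} (p : ℕ)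
    (π : Equiv.Perm (Fin n)) (σ : BSimplex G n) : BSimplex H n :=
  fun i => if (π.symm i : ℕ) < p then g (σ (π.symm i)) else f (σ (π.symm i))

/-- `m(x) = h(x)⁻¹ ℓ f(x)`. -/
def pillarValue {G H : Type u} [Group G] [Group H] (f h : G →* H) (ℓ : H) (x : G) : H :=
  (h x)⁻¹ * ℓ * f x

/-- The pillars of the `(p, n - p)`-shuffle `π` on `σ = [g₁, …, gₙ]`: if, among the first `r` entries
of the shuffled simplex, `a` belong to `{g₁, …, g_p}` and `c` to `{g_{p+1}, …, gₙ}`, then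
`t_r = m(g_{a+1} g_{a+2} ⋯ g_{p+c})`. So `t₀ = m(g₁ ⋯ g_p)`; passing an entry `f(g_j)` multiplies the
argument by `g_j` on the right, and passing an entry `g(g_j)` removes its leftmost factor `g_j`. -/
def pillars {G H : Type u} [Group G] [Group H] (f h : G →* H) (ℓ : H) {n : ℕ} (p : ℕ)
    (π : Equiv.Perm (Fin n)) (σ : BSimplex G n) : Fin (n + 1) → H :=
  fun r =>
    let a := ((Finset.univ : Finset (Fin n)).filter
      fun j : Fin n => (j : ℕ) < p ∧ (π j : Fin n).val < r).card
    let c := ((Finset.univ : Finset (Fin n)).filter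
      fun j : Fin n => p ≤ (j : ℕ) ∧ (π j : Fin n).val < r).card
    pillarValue f h ℓ (((List.ofFn σ).take (p + c)).drop a).prod

/-- The signed sum of the simplicial cylinders between the simplices of `Ed_{(f,g)}(σ)` and of
`Ed_{(h,k)}(σ)`, over all `(p, n - p)`-shuffles with `0 ≤ p ≤ n`. -/
def edgewiseCylinder {G H : Type u} [Group G] [Group H] (f g h k : G →* H) (ℓ : H) (n : ℕ) :
    Chains (BSimplex G n) →ₗ[ℤ] Chains (BSimplex H (n + 1)) :=
  Finsupp.linearCombination ℤ fun σ =>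
    ∑ p ∈ Finset.range (n + 1), ∑ π ∈ shuffles n p, (Equiv.Perm.sign π : ℤ) •
      cylinder (shuffleSimplex f g p π σ) (shuffleSimplex h k p π σ) (pillars f h ℓ p π σ)

/-- No two of the simplices `[b₁, …, b_r, t_r, a_{r+1}, …, a_n]` that occur in the sum
`edgewiseCylinder` at `σ` with opposite signs coincide. -/
def NoCancellation {G H : Type u} [Group G] [Group H] (f g h k : G →* H) (ℓ : H) {n : ℕ}
    (σ : BSimplex G n) : Prop :=
  ∀ p ∈ Finset.range (n + 1), ∀ π ∈ shuffles n p, ∀ r : Fin (n + 1),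
  ∀ p' ∈ Finset.range (n + 1), ∀ π' ∈ shuffles n p', ∀ r' : Fin (n + 1),
    cylinderSimplex (shuffleSimplex f g p π σ) (shuffleSimplex h k p π σ) (pillars f h ℓ p π σ) r =
      cylinderSimplex (shuffleSimplex f g p' π' σ) (shuffleSimplex h k p' π' σ)
        (pillars f h ℓ p' π' σ) r' →
    (Equiv.Perm.sign π : ℤ) * (-1) ^ (r : ℕ) = (Equiv.Perm.sign π' : ℤ) * (-1) ^ (r' : ℕ)

/-- The diameter of a chain, its `L¹`-norm. -/
def diameter {X : Type u} (c : Chains X) : ℕ :=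
  c.sum fun _ a => a.natAbs

/-- The diameter function of a chain homotopy: the supremum of the diameters of its values on
the simplices of dimension at most `m`. -/
def diameterFunction {G H : Type u} [Group G] [Group H] {E E' : moore G ⟶ moore H}
    (P : Homotopy E E') (m : ℕ) : ℕ∞ :=
  ⨆ (i : ℕ) (_ : i ≤ m) (σ : BSimplex G i),
    (diameter (X := BSimplex H (i + 1))
      ((P.hom i (i + 1)).hom (Finsupp.single σ 1 : Chains (BSimplex G i))) : ℕ∞)

/-- `E` is the edgewise subdivision `Ed_{(f,g)}`, as a morphism of chain complexes. -/
def IsEdgewise {G H : Type u} [Group G] [Group H] (f g : G →* H) (E : moore G ⟶ moore H) : Prop :=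
  ∀ n : ℕ, E.f n = ModuleCat.ofHom (edgewise f g n)

/-- The chain homotopy `P` is given by `edgewiseCylinder` in all positive degrees, and by
`[] ↦ c [ℓ]` in degree `0`. -/
def IsCylindrical {G H : Type u} [Group G] [Group H] (f g h k : G →* H) (ℓ : H) (c : ℤ)
    {E E' : moore G ⟶ moore H} (P : Homotopy E E') : Prop :=
  (P.hom 0 1).hom (Finsupp.single (fun i => i.elim0) 1 : Chains (BSimplex G 0)) =
      (Finsupp.single (fun _ => ℓ) c : Chains (BSimplex H 1)) ∧
    ∀ n : ℕ, 1 ≤ n → P.hom n (n + 1) = ModuleCat.ofHom (edgewiseCylinder f g h k ℓ n)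

end EdgewiseHomotopy

end

/-! The argument runs in homogeneous coordinates. A simplex $[g_1,\dots,g_n]$ is represented by a
list of vertices $x_0,\dots,x_n$ with $g_i=x_{i-1}^{-1}x_i$; faces then erase vertices, and left
translation of all vertices changes nothing. A $(p,q)$-shuffle becomes a lattice path through the
pairs $(x_a,x_b)$ with $a\le p\le b$. Since $f$ and $g$ commute, sending a pair $(x,y)$ to the
vertex $g(x)f(y)$ turns this path into the shuffled simplex (`shuffleSimplex_homogeneousSimplex`).
Thus $Ed_{(f,g)}$ is a universal operator on ordered simplices, `diagonalShuffle`, followed by a map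
of vertices.

The universal operator is compatible with boundaries by the Leibniz rule for shuffles
(`listBoundary_listShuffle`) and a telescoping over the vertex at which front and back face meet
(`listBoundary_frontBackShuffle`). Both are inductions on the first vertex, free of simplicial
indices.

For the homotopy, the two subdivisions use the vertices $A=\ell\,g(x)f(y)$ and $B=k(x)h(y)$; the
factor $\ell$ is invisible in $BH$. The ordinary prism between the two vertex maps has the edges
$B^{-1}A$ as pillars, and the relation between $\ell$ and the homomorphisms identifies $B^{-1}A$
with $m(x^{-1}y)$ (`pillars_homogeneousSimplex`). Hence the prism is the signed sum of simplicial
cylinders, and the prism formula `listBoundary_prism` gives `edgewiseCylinder_homotopy`. In degree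
$0$ the value is arbitrary, because the boundary from degree $1$ vanishes.

The shuffles for all $p$ together correspond to the $2^n$ words in two letters, and each cylinder
has $n+1$ simplices, whence the bound. A sum of signed simplices has diameter equal to its number of
terms exactly when nothing cancels. For a constant simplex $[x,\dots,x]$ with pillars outside
$\{h(x),k(x)\}$, every term reveals its pillar position and then its word, so all terms are distinct
(`noCancellation_const`). -/

noncomputable section

namespace EdgewiseHomotopy

/-! ### Ordered chains on lists of vertices. -/

section ListChains

variable {V W : Type*}

/-- The map of chains on lists that prepends `x`. -/
def consChain (x : V) : (List V →₀ ℤ) →ₗ[ℤ] (List V →₀ ℤ) :=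
  Finsupp.lmapDomain ℤ ℤ (List.cons x)

/-- The map of chains on lists that appends `x`. -/
def snocChain (x : V) : (List V →₀ ℤ) →ₗ[ℤ] (List V →₀ ℤ) :=
  Finsupp.lmapDomain ℤ ℤ (fun l => l ++ [x])

/-- The alternating sum of the lists obtained by erasing one entry. -/
def alternatingErase : List V → (List V →₀ ℤ)
  | [] => 0
  | x :: l => Finsupp.single l 1 - consChain x (alternatingErase l)

/-- The boundary of the augmented complex of ordered chains, on lists of vertices. -/
def listBoundary : (List V →₀ ℤ) →ₗ[ℤ] (List V →₀ ℤ) :=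
  Finsupp.linearCombination ℤ alternatingErase

/-- The grading involution `l ↦ (-1)^|l| l`. -/
def gradingInvolution : (List V →₀ ℤ) →ₗ[ℤ] (List V →₀ ℤ) :=
  Finsupp.linearCombination ℤ fun l => (-1 : ℤ) ^ l.length • Finsupp.single l 1

@[simp] theorem consChain_single (x : V) (l : List V) (c : ℤ) :
    consChain x (Finsupp.single l c) = Finsupp.single (x :: l) c := by
  simp [consChain, Finsupp.mapDomain_single]

@[simp] theorem snocChain_single (x : V) (l : List V) (c : ℤ) :
    snocChain x (Finsupp.single l c) = Finsupp.single (l ++ [x]) c := by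
  simp [snocChain, Finsupp.mapDomain_single]

@[simp] theorem listBoundary_single (l : List V) :
    listBoundary (Finsupp.single l 1) = alternatingErase l := by
  simp [listBoundary]

@[simp] theorem gradingInvolution_single (l : List V) :
    gradingInvolution (Finsupp.single l 1) = (-1 : ℤ) ^ l.length • Finsupp.single l 1 := by
  simp [gradingInvolution]

/-- This is the cone formula: erasing the apex returns the base, and erasing any later vertex shifts
its index, hence its sign, by one. It reduces the boundary computations below to inductions on the
first vertex. -/
theorem listBoundary_consChain (x : V) (c : List V →₀ ℤ) :
    listBoundary (consChain x c) = c - consChain x (listBoundary c) := by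
  suffices h : listBoundary ∘ₗ consChain x = LinearMap.id - consChain x ∘ₗ listBoundary from
    LinearMap.congr_fun h c
  refine Finsupp.lhom_ext' fun l => LinearMap.ext_ring ?_
  simp [alternatingErase]

theorem gradingInvolution_consChain (x : V) (c : List V →₀ ℤ) :
    gradingInvolution (consChain x c) = -consChain x (gradingInvolution c) := by
  suffices h : gradingInvolution ∘ₗ consChain x = -(consChain x ∘ₗ gradingInvolution) from
    LinearMap.congr_fun h c
  refine Finsupp.lhom_ext' fun l => LinearMap.ext_ring ?_
  simp [pow_succ]

theorem gradingInvolution_alternatingErase (l : List V) :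
    gradingInvolution (alternatingErase l) = -((-1 : ℤ) ^ l.length • alternatingErase l) := by
  induction l with
  | nil => simp [alternatingErase]
  | cons x l ih =>
    simp only [alternatingErase, map_sub, gradingInvolution_single, gradingInvolution_consChain, ih,
      List.length_cons, pow_succ, map_neg, map_smul]
    module

theorem alternatingErase_append_singleton (l : List V) (y : V) :
    alternatingErase (l ++ [y]) =
      snocChain y (alternatingErase l) + (-1 : ℤ) ^ l.length • Finsupp.single l 1 := by
  have hcomm : ∀ (x : V) (c : List V →₀ ℤ),
      consChain x (snocChain y c) = snocChain y (consChain x c) := by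
    intro x c
    suffices h : consChain x ∘ₗ snocChain y = snocChain y ∘ₗ consChain x from
      LinearMap.congr_fun h c
    refine Finsupp.lhom_ext' fun l => LinearMap.ext_ring ?_
    simp
  induction l with
  | nil => simp [alternatingErase]
  | cons x l ih =>
    simp only [List.cons_append, alternatingErase, ih, map_add, map_sub, map_smul,
      consChain_single, snocChain_single, hcomm, List.length_cons, pow_succ]
    module

/-- `1` on the empty list and `0` on the others. -/
def isNilIndicator : (List V →₀ ℤ) →ₗ[ℤ] ℤ :=
  Finsupp.lapply []

/-! ### The shuffle product and its Leibniz rule. -/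

/-- The shuffle product of two ordered simplices, given by their lists of vertices, in the
ordered chains of the product. -/
def listShuffle : List V → List W → (List (V × W) →₀ ℤ)
  | [], _ => 0
  | _ :: _, [] => 0
  | x :: u, y :: v =>
    consChain (x, y)
      ((isNilIndicator (Finsupp.single u 1) * isNilIndicator (Finsupp.single v 1)) •
          Finsupp.single [] 1 +
        listShuffle u (y :: v) + (-1 : ℤ) ^ u.length • listShuffle (x :: u) v)
termination_by u v => u.length + v.length

/-- The bilinear extension of `listShuffle`. -/
def chainShuffle : (List V →₀ ℤ) →ₗ[ℤ] (List W →₀ ℤ) →ₗ[ℤ] (List (V × W) →₀ ℤ) :=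
  Finsupp.linearCombination ℤ fun u => Finsupp.linearCombination ℤ fun v => listShuffle u v

@[simp] theorem chainShuffle_single (u : List V) (v : List W) :
    chainShuffle (Finsupp.single u 1) (Finsupp.single v 1) = listShuffle u v := by
  simp [chainShuffle]

@[simp] theorem listShuffle_nil_left (v : List W) : listShuffle ([] : List V) v = 0 := by
  rw [listShuffle]

@[simp] theorem listShuffle_nil_right (u : List V) : listShuffle u ([] : List W) = 0 := by
  cases u <;> rw [listShuffle]

/-- The recursion of `listShuffle` in bilinear form. The sign depends on the length of the first
list, so for chains it has to be carried by the grading involution. -/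
theorem chainShuffle_cons (x : V) (y : W) (c : List V →₀ ℤ) (d : List W →₀ ℤ) :
    chainShuffle (consChain x c) (consChain y d) =
      consChain (x, y) ((isNilIndicator c * isNilIndicator d) • Finsupp.single [] 1 +
        chainShuffle c (consChain y d) + chainShuffle (consChain x (gradingInvolution c)) d) := by
  induction c using Finsupp.induction_linear with
  | zero => simp
  | add c c' hc hc' =>
    simp only [map_add, LinearMap.add_apply, hc, hc', add_mul, add_smul]
    abel
  | single u a =>
    induction d using Finsupp.induction_linear with
    | zero => simp
    | add d d' hd hd' =>
      simp only [map_add, hd, hd', mul_add, add_smul]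
      abel
    | single v b =>
      rw [← mul_one a, ← smul_eq_mul, ← Finsupp.smul_single, ← mul_one b, ← smul_eq_mul,
        ← Finsupp.smul_single]
      simp only [map_smul, LinearMap.smul_apply, consChain_single, chainShuffle_single,
        gradingInvolution_single, smul_eq_mul]
      rw [listShuffle]
      simp only [← map_smul]
      congr 1
      module

theorem isNilIndicator_single_cons (x : V) (l : List V) :
    isNilIndicator (Finsupp.single (x :: l) 1) = 0 := by
  simp [isNilIndicator]

theorem isNilIndicator_consChain (x : V) (c : List V →₀ ℤ) : isNilIndicator (consChain x c) = 0 := by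
  suffices h : isNilIndicator ∘ₗ consChain x = 0 from LinearMap.congr_fun h c
  refine Finsupp.lhom_ext' fun l => LinearMap.ext_ring ?_
  simp [isNilIndicator]

theorem isNilIndicator_alternatingErase_cons (x : V) (l : List V) :
    isNilIndicator (alternatingErase (x :: l)) = isNilIndicator (Finsupp.single l 1) := by
  rw [alternatingErase, map_sub, isNilIndicator_consChain, sub_zero]

/-- The Leibniz rule for the shuffle product; the last term is due to the augmentation. -/
theorem listBoundary_listShuffle (u : List V) (v : List W) :
    listBoundary (listShuffle u v) =
      chainShuffle (alternatingErase u) (Finsupp.single v 1) -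
        (-1 : ℤ) ^ u.length • chainShuffle (Finsupp.single u 1) (alternatingErase v) +
        (isNilIndicator (alternatingErase u) * isNilIndicator (alternatingErase v)) •
          Finsupp.single [] 1 := by
  induction hn : u.length + v.length using Nat.strong_induction_on generalizing u v with
  | _ n ih =>
  match u, v with
  | [], v =>
    have h : ∀ d : List W →₀ ℤ, chainShuffle (Finsupp.single ([] : List V) 1) d = 0 := by
      intro d
      suffices h : chainShuffle (Finsupp.single ([] : List V) 1) = 0 from
        LinearMap.congr_fun h d
      refine Finsupp.lhom_ext' fun l => LinearMap.ext_ring ?_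
      simp
    simp [h, alternatingErase]
  | x :: u, [] =>
    have h : ∀ d : List V →₀ ℤ, chainShuffle d (Finsupp.single ([] : List W) 1) = 0 := by
      intro d
      suffices h : chainShuffle.flip (Finsupp.single ([] : List W) 1) = 0 from
        LinearMap.congr_fun h d
      refine Finsupp.lhom_ext' fun l => LinearMap.ext_ring ?_
      simp
    simp [h, alternatingErase]
  | x :: u, y :: v =>
    -- After the common first vertex, a path advances in one of the two factors; either way the
    -- total length drops, which is why the induction is on the sum of the lengths.
    have h1 := ih _ (by simp at hn ⊢; omega) u (y :: v) rfl
    have h2 := ih _ (by simp at hn ⊢; omega) (x :: u) v rfl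
    simp only [isNilIndicator_alternatingErase_cons] at h1 h2 ⊢
    rw [listShuffle, listBoundary_consChain]
    simp only [map_add, map_smul, h1, h2]
    simp only [alternatingErase, map_sub, LinearMap.sub_apply, ← consChain_single,
      chainShuffle_cons, gradingInvolution_alternatingErase, listBoundary_single,
      List.length_cons, pow_succ]
    simp only [consChain_single, chainShuffle_single, map_add, map_smul, map_neg,
      gradingInvolution_single, LinearMap.neg_apply, LinearMap.smul_apply, map_zero, smul_zero,
      map_sub]
    -- Fixing the parity of the length makes products of signs numerical, and the remaining identity
    -- is linear.
    rcases neg_one_pow_eq_or ℤ u.length with hs | hs <;> rw [hs] <;> module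

/-- The sum of the products of the front faces and the back faces of an ordered simplex `u ++ l`
at the vertices of `l`. -/
def frontBackShuffle : List V → (List V →₀ ℤ) →ₗ[ℤ] (List (V × V) →₀ ℤ)
  | [] => 0
  | y :: v => chainShuffle.flip (Finsupp.single (y :: v) 1) ∘ₗ snocChain y +
      frontBackShuffle v ∘ₗ snocChain y

/-- `frontBackShuffle`, linear in the second argument. -/
def frontBackChain (u : List V) : (List V →₀ ℤ) →ₗ[ℤ] (List (V × V) →₀ ℤ) :=
  Finsupp.linearCombination ℤ fun l => frontBackShuffle l (Finsupp.single u 1)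

@[simp] theorem frontBackChain_single (u l : List V) :
    frontBackChain u (Finsupp.single l 1) = frontBackShuffle l (Finsupp.single u 1) := by
  simp [frontBackChain]

theorem frontBackChain_consChain (u : List V) (y : V) (d : List V →₀ ℤ) :
    frontBackChain u (consChain y d) =
      chainShuffle (Finsupp.single (u ++ [y]) 1) (consChain y d) +
        frontBackChain (u ++ [y]) d := by
  suffices h : frontBackChain u ∘ₗ consChain y =
      chainShuffle (Finsupp.single (u ++ [y]) 1) ∘ₗ consChain y + frontBackChain (u ++ [y]) from
    LinearMap.congr_fun h d
  refine Finsupp.lhom_ext' fun l => LinearMap.ext_ring ?_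
  simp [frontBackShuffle]

/-- When front and back face meet at a vertex `y`, erasing `y` from the back face cancels against
erasing the last vertex of the front face in the next summand. The telescoping leaves only the first
term, `listShuffle u l`, which vanishes for empty `u`. The multiple of the empty list comes from the
augmentation. -/
theorem listBoundary_frontBackShuffle (u l : List V) :
    listBoundary (frontBackShuffle l (Finsupp.single u 1)) =
      frontBackShuffle l (alternatingErase u) +
        (-1 : ℤ) ^ u.length • frontBackChain u (alternatingErase l) +
        (-1 : ℤ) ^ u.length • listShuffle u l +
        (isNilIndicator (Finsupp.single u 1) * isNilIndicator (alternatingErase l)) •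
          Finsupp.single [] 1 := by
  induction l generalizing u with
  | nil => simp [frontBackShuffle, alternatingErase]
  | cons y v ih =>
    have hnil : isNilIndicator (alternatingErase (u ++ [y])) =
        isNilIndicator (Finsupp.single u 1) := by
      cases u with
      | nil => simp [alternatingErase, isNilIndicator]
      | cons x u =>
        rw [List.cons_append, isNilIndicator_alternatingErase_cons]
        simp [isNilIndicator]
    have hnil' : isNilIndicator (Finsupp.single (u ++ [y]) 1) = 0 := by
      simp [isNilIndicator]
    have h1 := ih (u ++ [y])
    simp only [frontBackShuffle, LinearMap.add_apply, LinearMap.comp_apply, snocChain_single,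
      LinearMap.flip_apply, map_add, listBoundary_listShuffle, chainShuffle_single, h1,
      isNilIndicator_alternatingErase_cons, hnil, hnil']
    simp only [map_add, LinearMap.add_apply, alternatingErase_append_singleton,
      chainShuffle_single, List.length_append, List.length_cons, List.length_nil, alternatingErase, map_sub,
      frontBackChain_consChain, frontBackChain_single, map_smul, LinearMap.smul_apply]
    rcases neg_one_pow_eq_or ℤ u.length with hs | hs <;> simp only [pow_add, hs] <;> module

/-- The composite of the diagonal, the Alexander–Whitney map and the shuffle map on ordered
chains. -/
def diagonalShuffle : (List V →₀ ℤ) →ₗ[ℤ] (List (V × V) →₀ ℤ) :=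
  frontBackChain []

/-- A single vertex must be excluded: its augmented boundary is the empty list, which
`diagonalShuffle` kills, whereas the boundary of the resulting pair is not zero. -/
theorem listBoundary_diagonalShuffle {l : List V} (hl : 2 ≤ l.length) :
    listBoundary (diagonalShuffle (Finsupp.single l 1)) =
      diagonalShuffle (alternatingErase l) := by
  rw [diagonalShuffle, frontBackChain_single, listBoundary_frontBackShuffle]
  match l, hl with
  | x :: y :: l, _ =>
    rw [isNilIndicator_alternatingErase_cons, isNilIndicator_single_cons]
    simp [alternatingErase]

theorem frontBackShuffle_eq_sum (u l : List V) :
    frontBackShuffle l (Finsupp.single u 1) =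
      ∑ p ∈ Finset.range l.length, listShuffle (u ++ l.take (p + 1)) (l.drop p) := by
  induction l generalizing u with
  | nil => simp [frontBackShuffle]
  | cons y v ih =>
    simp only [frontBackShuffle, LinearMap.add_apply, LinearMap.comp_apply, snocChain_single, ih,
      LinearMap.flip_apply, chainShuffle_single, List.length_cons, Finset.sum_range_succ']
    rw [add_comm]
    simp

theorem diagonalShuffle_single (l : List V) :
    diagonalShuffle (Finsupp.single l 1) =
      ∑ p ∈ Finset.range l.length, listShuffle (l.take (p + 1)) (l.drop p) := by
  rw [diagonalShuffle, frontBackChain_single, frontBackShuffle_eq_sum]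
  simp

/-! ### The prism operator. -/

/-- Regard a chain as a chain at the end `b` of the cylinder. -/
def cylinderEnd (b : Bool) : (List V →₀ ℤ) →ₗ[ℤ] (List (V × Bool) →₀ ℤ) :=
  Finsupp.lmapDomain ℤ ℤ (List.map fun v => (v, b))

/-- The prism on an ordered simplex. -/
def listPrism : List V → (List (V × Bool) →₀ ℤ)
  | [] => 0
  | x :: l => consChain (x, true) (consChain (x, false) (cylinderEnd false (Finsupp.single l 1))) -
      consChain (x, true) (listPrism l)

/-- The prism operator. -/
def prism : (List V →₀ ℤ) →ₗ[ℤ] (List (V × Bool) →₀ ℤ) :=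
  Finsupp.linearCombination ℤ listPrism

@[simp] theorem prism_single (l : List V) : prism (Finsupp.single l 1) = listPrism l := by
  simp [prism]

theorem cylinderEnd_single (b : Bool) (l : List V) :
    cylinderEnd b (Finsupp.single l 1) = Finsupp.single (l.map fun v => (v, b)) 1 := by
  simp [cylinderEnd, Finsupp.mapDomain_single]

theorem cylinderEnd_consChain (b : Bool) (x : V) (c : List V →₀ ℤ) :
    cylinderEnd b (consChain x c) = consChain (x, b) (cylinderEnd b c) := by
  suffices h : cylinderEnd b ∘ₗ consChain x = consChain (x, b) ∘ₗ cylinderEnd b from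
    LinearMap.congr_fun h c
  refine Finsupp.lhom_ext' fun l => LinearMap.ext_ring ?_
  simp [cylinderEnd_single]

theorem listBoundary_cylinderEnd (b : Bool) (c : List V →₀ ℤ) :
    listBoundary (cylinderEnd b c) = cylinderEnd b (listBoundary c) := by
  suffices h : listBoundary ∘ₗ cylinderEnd b = cylinderEnd (V := V) b ∘ₗ listBoundary from
    LinearMap.congr_fun h c
  refine Finsupp.lhom_ext' fun l => LinearMap.ext_ring ?_
  simp only [LinearMap.comp_apply, Finsupp.lsingle_apply, listBoundary_single, cylinderEnd_single]
  induction l with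
  | nil => simp [alternatingErase]
  | cons x l ih =>
    simp only [List.map_cons, alternatingErase, ih, map_sub, cylinderEnd_consChain,
      cylinderEnd_single]

theorem prism_consChain (x : V) (c : List V →₀ ℤ) :
    prism (consChain x c) =
      consChain (x, true) (consChain (x, false) (cylinderEnd false c)) -
        consChain (x, true) (prism c) := by
  suffices h : prism ∘ₗ consChain x =
      consChain (x, true) ∘ₗ consChain (x, false) ∘ₗ cylinderEnd false -
        consChain (x, true) ∘ₗ prism from LinearMap.congr_fun h c
  refine Finsupp.lhom_ext' fun l => LinearMap.ext_ring ?_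
  simp [listPrism]

/-- The usual prism formula, without bookkeeping of the cancelling inner faces: the cone formula
reduces it to the shorter list. -/
theorem listBoundary_prism (c : List V →₀ ℤ) :
    listBoundary (prism c) + prism (listBoundary c) = cylinderEnd false c - cylinderEnd true c := by
  suffices h : listBoundary ∘ₗ prism + prism ∘ₗ listBoundary =
      cylinderEnd (V := V) false - cylinderEnd true from LinearMap.congr_fun h c
  refine Finsupp.lhom_ext' fun l => LinearMap.ext_ring ?_
  simp only [LinearMap.comp_apply, LinearMap.add_apply, LinearMap.sub_apply,
    Finsupp.lsingle_apply, prism_single, listBoundary_single]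
  induction l with
  | nil => simp [listPrism, alternatingErase, cylinderEnd_single]
  | cons x l ih =>
    rw [← eq_sub_iff_add_eq] at ih
    simp only [listPrism, alternatingErase, map_sub, listBoundary_consChain, ih, prism_consChain,
      listBoundary_cylinderEnd, ← consChain_single, cylinderEnd_consChain, prism_single,
      listBoundary_single]
    abel

theorem listPrism_eq_sum (l : List V) :
    listPrism l = ∑ r ∈ Finset.range l.length, (-1 : ℤ) ^ r •
      Finsupp.single ((l.take (r + 1)).map (fun v => (v, true)) ++
        (l.drop r).map fun v => (v, false)) 1 := by
  induction l with
  | nil => simp [listPrism]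
  | cons x l ih =>
    simp only [listPrism, ih, List.length_cons, Finset.sum_range_succ', cylinderEnd_single,
      consChain_single, map_sum, map_smul, pow_succ]
    rw [sub_eq_add_neg, add_comm]
    simp

end ListChains

/-! ### Shuffles as words in two letters and as lattice paths. -/

section Words

/-- The sign of the shuffle described by a word, whose letter `true` stands for an entry of the
first factor and whose letter `false` stands for one of the second factor. -/
def wordSign : List Bool → ℤ
  | [] => 1
  | true :: w => wordSign w
  | false :: w => (-1) ^ w.count true * wordSign w

theorem count_true_ofFn {n : ℕ} (w : Fin n → Bool) :
    (List.ofFn w).count true = ∑ i, if w i then 1 else 0 := by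
  induction n with
  | zero => simp
  | succ n ih =>
    rw [List.ofFn_succ, List.count_cons, ih, Fin.sum_univ_succ, add_comm]
    simp

theorem count_true_ofFn_eq_card {n : ℕ} (w : Fin n → Bool) :
    (List.ofFn w).count true = (Finset.univ.filter fun i => w i = true).card := by
  rw [count_true_ofFn, Finset.card_filter]

/-- The recursive sign counts, for each `false`, the later letters `true`; these pairs are the
inversions of the shuffle. This form matches the product formula for the sign of a permutation. -/
theorem wordSign_ofFn {n : ℕ} (w : Fin n → Bool) :
    wordSign (List.ofFn w) =
      ∏ i, ∏ j ∈ Finset.Ioi i, if w i = false ∧ w j = true then (-1 : ℤ) else 1 := by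
  induction n with
  | zero => simp [wordSign]
  | succ n ih =>
    rw [List.ofFn_succ, Fin.prod_univ_succ, Fin.prod_Ioi_zero]
    simp only [Fin.prod_Ioi_succ]
    rw [← ih]
    cases h : w 0 with
    | true => simp [wordSign]
    | false =>
      rw [wordSign, count_true_ofFn_eq_card]
      simp [Finset.prod_ite]

theorem sum_words_succ {M : Type*} [AddCommMonoid M] {n : ℕ} (F : List Bool → M) :
    ∑ w : Fin (n + 1) → Bool, F (List.ofFn w) =
      ∑ w : Fin n → Bool, F (true :: List.ofFn w) +
        ∑ w : Fin n → Bool, F (false :: List.ofFn w) := by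
  rw [← (Fin.consEquiv fun _ => Bool).sum_comp, Fintype.sum_prod_type, Fintype.sum_bool]
  simp [Fin.consEquiv, List.ofFn_succ]

theorem sum_words_filter_succ {M : Type*} [AddCommMonoid M] {n : ℕ} (P : List Bool → Prop)
    [DecidablePred P] (F : List Bool → M) :
    ∑ w : Fin (n + 1) → Bool with P (List.ofFn w), F (List.ofFn w) =
      ∑ w : Fin n → Bool with P (true :: List.ofFn w), F (true :: List.ofFn w) +
        ∑ w : Fin n → Bool with P (false :: List.ofFn w), F (false :: List.ofFn w) := by
  simp only [Finset.sum_filter]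
  exact sum_words_succ fun l => if P l then F l else 0

/-- The path in the grid with columns `u` and rows `v` that follows the word `w`. -/
def gridPath {V W : Type*} : List Bool → List V → List W → List (V × W)
  | [], x :: _, y :: _ => [(x, y)]
  | true :: w, x :: u, y :: v => (x, y) :: gridPath w u (y :: v)
  | false :: w, x :: u, y :: v => (x, y) :: gridPath w (x :: u) v
  | _, _, _ => []

/-- The two recursive terms of `listShuffle` are the words beginning with `true` and with `false`.
In the second, the sign counts the steps of the first factor that are still to come. -/
theorem listShuffle_eq_sum_words {V W : Type*} {n : ℕ} (u : List V) (v : List W)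
    (h : u.length + v.length = n + 2) :
    listShuffle u v =
      ∑ w : Fin n → Bool with (List.ofFn w).count true + 1 = u.length,
        wordSign (List.ofFn w) • Finsupp.single (gridPath (List.ofFn w) u v) 1 := by
  induction n generalizing u v with
  | zero =>
    match u, v, h with
    | [], v, _ => simp
    | [x], [y], _ =>
      simp [listShuffle, gridPath, wordSign, isNilIndicator, Finset.filter_true_of_mem]
    | x :: u, [], h =>
      have h' : u ≠ [] := by rintro rfl; simp at h
      simp [h']
    | [x], y :: y' :: v, h => simp at h; omega
    | x :: x' :: u, y :: v, h => simp at h; omega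
  | succ n ih =>
    match u, v, h with
    | [], v, _ => simp
    | x :: u, [], h =>
      rw [listShuffle_nil_right, Finset.sum_eq_zero]
      intro w hw
      -- A word in this sum would have more letters `true` than it has letters.
      have h1 := (List.ofFn w).count_le_length (a := true)
      simp only [Finset.mem_filter, List.length_cons, List.length_nil, List.length_ofFn] at *
      omega
    | x :: u, y :: v, h =>
      have h1 := ih u (y :: v) (by simp at h ⊢; omega)
      have h2 := ih (x :: u) v (by simp at h ⊢; omega)
      have hnil : isNilIndicator (Finsupp.single u 1) * isNilIndicator (Finsupp.single v 1) = 0 := by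
        match u, v, h with
        | [], [], h => simp at h
        | _ :: _, _, _ => simp [isNilIndicator]
        | _, _ :: _, _ => simp [isNilIndicator]
      rw [listShuffle, hnil, zero_smul, zero_add, h1, h2, map_add,
        sum_words_filter_succ (fun l => l.count true + 1 = (x :: u).length)
          (fun l => wordSign l • Finsupp.single (gridPath l (x :: u) (y :: v)) (1 : ℤ))]
      congr 1
      · simp [map_sum, wordSign, gridPath]
      · rw [map_smul, map_sum, Finset.smul_sum]
        refine Finset.sum_congr (by simp) fun w hw => ?_
        have hw' : (List.ofFn w).count true = u.length := by simpa using hw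
        rw [map_smul, smul_smul, wordSign, hw', gridPath, consChain_single]

theorem length_gridPath {V W : Type*} (w : List Bool) (u : List V) (v : List W)
    (hu : u.length = w.count true + 1) (hv : v.length = w.count false + 1) :
    (gridPath w u v).length = w.length + 1 := by
  induction w generalizing u v with
  | nil =>
    match u, v, hu, hv with
    | [x], [y], _, _ => simp [gridPath]
  | cons b w ih =>
    match b, u, v, hu, hv with
    | true, x :: u, y :: v, hu, hv =>
      simp only [gridPath, List.length_cons]
      rw [ih u (y :: v) (by simpa using hu) (by simpa using hv)]
    | false, x :: u, y :: v, hu, hv =>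
      simp only [gridPath, List.length_cons]
      rw [ih (x :: u) v (by simpa using hu) (by simpa using hv)]

/-- Each letter advances exactly one coordinate, so the position after `r` letters is given by the
two letter counts. This connects the recursive path with the counts `a` and `c` in the definition of
the pillars. -/
theorem getD_gridPath {V W : Type*} (w : List Bool) (u : List V) (v : List W)
    (hu : u.length = w.count true + 1) (hv : v.length = w.count false + 1) (d : V) (d' : W)
    (r : ℕ) (hr : r ≤ w.length) :
    (gridPath w u v).getD r (d, d') =
      (u.getD ((w.take r).count true) d, v.getD ((w.take r).count false) d') := by
  induction w generalizing u v r with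
  | nil =>
    match u, v, hu, hv with
    | [x], [y], _, _ =>
      obtain rfl : r = 0 := by simpa using hr
      simp [gridPath]
  | cons b w ih =>
    match b, u, v, hu, hv, r with
    | true, x :: u, y :: v, hu, hv, 0 => simp [gridPath]
    | false, x :: u, y :: v, hu, hv, 0 => simp [gridPath]
    | true, x :: u, y :: v, hu, hv, r + 1 =>
      simp only [gridPath, List.getD_cons_succ, List.take_succ_cons]
      rw [ih u (y :: v) (by simpa using hu) (by simpa using hv) r (by simpa using hr)]
      simp
    | false, x :: u, y :: v, hu, hv, r + 1 =>
      simp only [gridPath, List.getD_cons_succ, List.take_succ_cons]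
      rw [ih (x :: u) v (by simpa using hu) (by simpa using hv) r (by simpa using hr)]
      simp

end Words

/-! ### Permutations that are shuffles, and their words. -/

section Shuffles

variable {n : ℕ}

/-- The word of a permutation `π`: whether the entry at a place is one of the first `p`. -/
def shuffleWord (p : ℕ) (π : Equiv.Perm (Fin n)) : Fin n → Bool :=
  fun i => decide ((π.symm i : ℕ) < p)

/-- The number of the first `p` entries that stand at the first `r` places. -/
def leftCount (p : ℕ) (π : Equiv.Perm (Fin n)) (r : ℕ) : ℕ :=
  ((Finset.univ : Finset (Fin n)).filter
    fun j : Fin n => (j : ℕ) < p ∧ (π j : Fin n).val < r).card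

/-- The number of entries other than the first `p` that stand at the first `r` places. -/
def rightCount (p : ℕ) (π : Equiv.Perm (Fin n)) (r : ℕ) : ℕ :=
  ((Finset.univ : Finset (Fin n)).filter
    fun j : Fin n => p ≤ (j : ℕ) ∧ (π j : Fin n).val < r).card

theorem mem_shuffles {p : ℕ} {π : Equiv.Perm (Fin n)} :
    π ∈ shuffles n p ↔
      ∀ i j : Fin n, i < j → ((j : ℕ) < p ∨ p ≤ (i : ℕ)) → π i < π j := by
  simp [shuffles]

theorem leftCount_zero (p : ℕ) (π : Equiv.Perm (Fin n)) : leftCount p π 0 = 0 := by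
  simp [leftCount]

theorem rightCount_zero (p : ℕ) (π : Equiv.Perm (Fin n)) : rightCount p π 0 = 0 := by
  simp [rightCount]

theorem leftCount_add_rightCount (p : ℕ) (π : Equiv.Perm (Fin n)) {r : ℕ} (hr : r ≤ n) :
    leftCount p π r + rightCount p π r = r := by
  have h1 : leftCount p π r + rightCount p π r =
      ((Finset.univ : Finset (Fin n)).filter fun j => (π j : Fin n).val < r).card := by
    rw [leftCount, rightCount, ← Finset.card_union_of_disjoint]
    · congr 1
      ext j
      simp only [Finset.mem_union, Finset.mem_filter, Finset.mem_univ, true_and]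
      omega
    · rw [Finset.disjoint_left]
      intro j
      simp only [Finset.mem_filter, Finset.mem_univ, true_and]
      omega
  have h2 : ((Finset.univ : Finset (Fin n)).filter fun j => (π j : Fin n).val < r) =
      ((Finset.univ : Finset (Fin n)).filter fun j => j.val < r).map π.symm.toEmbedding := by
    ext j
    simp [Finset.mem_map_equiv]
  rw [h1, h2, Finset.card_map, Fin.card_filter_val_lt, min_eq_right hr]

theorem leftCount_le (p : ℕ) (π : Equiv.Perm (Fin n)) (r : ℕ) : leftCount p π r ≤ p := by
  calc leftCount p π r ≤ ((Finset.univ : Finset (Fin n)).filter fun j => j.val < p).card :=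
        Finset.card_le_card fun j => by
          simp only [Finset.mem_filter, Finset.mem_univ, true_and]; omega
    _ ≤ p := by rw [Fin.card_filter_val_lt]; exact min_le_right _ _

theorem leftCount_succ_of_lt {p : ℕ} {π : Equiv.Perm (Fin n)} {i : Fin n}
    (h : (π.symm i : ℕ) < p) : leftCount p π (i + 1) = leftCount p π i + 1 := by
  have h1 : ((Finset.univ : Finset (Fin n)).filter
      fun j : Fin n => (j : ℕ) < p ∧ (π j : Fin n).val < i + 1) =
      insert (π.symm i) ((Finset.univ : Finset (Fin n)).filter
      fun j : Fin n => (j : ℕ) < p ∧ (π j : Fin n).val < i) := by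
    ext j
    have : j = π.symm i ↔ (π j).val = i := by
      rw [Equiv.eq_symm_apply, Fin.ext_iff]
    simp only [Finset.mem_filter, Finset.mem_univ, true_and, Finset.mem_insert, this]
    constructor
    · omega
    · rintro (hj | hj)
      · rw [← this] at hj
        subst hj
        simp [h]
      · omega
  rw [leftCount, h1, Finset.card_insert_of_notMem (by simp), leftCount]

theorem leftCount_succ_of_le {p : ℕ} {π : Equiv.Perm (Fin n)} {i : Fin n}
    (h : p ≤ (π.symm i : ℕ)) : leftCount p π (i + 1) = leftCount p π i := by
  rw [leftCount, leftCount]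
  congr 1
  ext j
  simp only [Finset.mem_filter, Finset.mem_univ, true_and]
  constructor
  · rintro ⟨h1, h2⟩
    refine ⟨h1, lt_of_le_of_ne (by omega) fun h3 => ?_⟩
    obtain rfl : j = π.symm i := by rw [Equiv.eq_symm_apply, Fin.ext_iff, h3]
    omega
  · omega

theorem rightCount_succ_of_lt {p : ℕ} {π : Equiv.Perm (Fin n)} {i : Fin n}
    (h : (π.symm i : ℕ) < p) : rightCount p π (i + 1) = rightCount p π i := by
  have h1 := leftCount_add_rightCount p π (r := i) (by omega)
  have h2 := leftCount_add_rightCount p π (r := i + 1) (by omega)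
  rw [leftCount_succ_of_lt h] at h2
  omega

theorem rightCount_succ_of_le {p : ℕ} {π : Equiv.Perm (Fin n)} {i : Fin n}
    (h : p ≤ (π.symm i : ℕ)) : rightCount p π (i + 1) = rightCount p π i + 1 := by
  have h1 := leftCount_add_rightCount p π (r := i) (by omega)
  have h2 := leftCount_add_rightCount p π (r := i + 1) (by omega)
  rw [leftCount_succ_of_le h] at h2
  omega

/-- A shuffle keeps the first `p` entries in order, so those standing before the one at place `i`
are precisely those of smaller index. -/
theorem leftCount_eq {p : ℕ} {π : Equiv.Perm (Fin n)} (hπ : π ∈ shuffles n p) {i : Fin n}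
    (h : (π.symm i : ℕ) < p) : leftCount p π i = π.symm i := by
  rw [mem_shuffles] at hπ
  rw [leftCount, ← Fin.card_Iio (π.symm i)]
  congr 1
  ext j
  simp only [Finset.mem_filter, Finset.mem_univ, true_and, Finset.mem_Iio]
  rcases lt_trichotomy j (π.symm i) with hj | hj | hj
  · have := hπ _ _ hj (Or.inl h)
    rw [Equiv.apply_symm_apply] at this
    have h3 : (j : ℕ) < π.symm i := hj
    simp only [hj, iff_true]
    exact ⟨by omega, this⟩
  · subst hj
    simp
  · have h3 : ¬ j < π.symm i := not_lt.mpr hj.le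
    simp only [h3, iff_false, not_and]
    intro h4 h5
    have := hπ _ _ hj (Or.inl h4)
    rw [Equiv.apply_symm_apply] at this
    have h6 : (i : ℕ) < π j := this
    omega

theorem rightCount_eq {p : ℕ} {π : Equiv.Perm (Fin n)} (hπ : π ∈ shuffles n p) {i : Fin n}
    (h : p ≤ (π.symm i : ℕ)) : p + rightCount p π i = π.symm i := by
  rw [mem_shuffles] at hπ
  have hp : p < n := by omega
  have : rightCount p π i = (Finset.Ico (⟨p, hp⟩ : Fin n) (π.symm i)).card := by
    rw [rightCount]
    congr 1
    ext j
    simp only [Finset.mem_filter, Finset.mem_univ, true_and, Finset.mem_Ico, Fin.le_def]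
    refine and_congr_right fun hpj => ?_
    rcases lt_trichotomy j (π.symm i) with hj | hj | hj
    · have := hπ _ _ hj (Or.inr hpj)
      rw [Equiv.apply_symm_apply] at this
      simp only [hj, iff_true]
      exact this
    · subst hj
      simp
    · have h3 : ¬ j < π.symm i := not_lt.mpr hj.le
      simp only [h3, iff_false]
      have := hπ _ _ hj (Or.inr h)
      rw [Equiv.apply_symm_apply] at this
      have h6 : (i : ℕ) < π j := this
      omega
  rw [this, Fin.card_Ico]
  simp only
  omega

theorem count_take_shuffleWord (p : ℕ) (π : Equiv.Perm (Fin n)) {r : ℕ} (hr : r ≤ n) :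
    ((List.ofFn (shuffleWord p π)).take r).count true = leftCount p π r ∧
      ((List.ofFn (shuffleWord p π)).take r).count false = rightCount p π r := by
  induction r with
  | zero => simp [leftCount_zero, rightCount_zero]
  | succ r ih =>
    obtain ⟨h1, h2⟩ := ih (by omega)
    have hr' : r < (List.ofFn (shuffleWord p π)).length := by simpa using hr
    rw [List.take_succ_eq_append_getElem hr', List.count_append, List.count_append, h1, h2]
    simp only [List.getElem_ofFn, shuffleWord]
    by_cases h : (π.symm ⟨r, by omega⟩ : ℕ) < p
    · have h3 := leftCount_succ_of_lt h
      have h4 := rightCount_succ_of_lt h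
      simp_all
    · have h3 := leftCount_succ_of_le (not_lt.mp h)
      have h4 := rightCount_succ_of_le (not_lt.mp h)
      simp_all

theorem leftCount_self {p : ℕ} (hp : p ≤ n) (π : Equiv.Perm (Fin n)) : leftCount p π n = p := by
  simp [leftCount, Fin.card_filter_val_lt, hp]

theorem rightCount_self {p : ℕ} (hp : p ≤ n) (π : Equiv.Perm (Fin n)) :
    p + rightCount p π n = n := by
  have := leftCount_add_rightCount p π (le_refl n)
  rwa [leftCount_self hp] at this

theorem count_shuffleWord {p : ℕ} (hp : p ≤ n) (π : Equiv.Perm (Fin n)) :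
    (List.ofFn (shuffleWord p π)).count true = p ∧
      p + (List.ofFn (shuffleWord p π)).count false = n := by
  have h := count_take_shuffleWord p π (le_refl n)
  rw [List.take_of_length_le (by simp)] at h
  rw [h.1, h.2, leftCount_self hp, rightCount_self hp]
  exact ⟨rfl, rfl⟩

/-- The inverse permutation has the same sign, and its inversions are pairs of places. For a
shuffle, two places are inverted only if the earlier carries one of the last entries and the later
one of the first `p`. -/
theorem sign_eq_wordSign {p : ℕ} {π : Equiv.Perm (Fin n)} (hπ : π ∈ shuffles n p) :
    (Equiv.Perm.sign π : ℤ) = wordSign (List.ofFn (shuffleWord p π)) := by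
  rw [← Equiv.Perm.sign_symm, Equiv.Perm.sign_eq_prod_prod_Ioi, wordSign_ofFn]
  push_cast
  refine Finset.prod_congr rfl fun i _ => Finset.prod_congr rfl fun j hj => ?_
  rw [Finset.mem_Ioi] at hj
  rw [mem_shuffles] at hπ
  have h1 : π.symm i < π.symm j ∨ (p ≤ (π.symm i : ℕ) ∧ (π.symm j : ℕ) < p) := by
    by_contra! h
    have hne : π.symm j ≠ π.symm i := fun h' => hj.ne' (π.symm.injective h')
    have := hπ _ _ (lt_of_le_of_ne h.1 hne)
    simp only [Equiv.apply_symm_apply] at this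
    have h2 := h.2
    rcases lt_or_ge (π.symm i : ℕ) p with h3 | h3
    · exact lt_asymm hj (this (Or.inl h3))
    · exact lt_asymm hj (this (Or.inr (h2 h3)))
  by_cases h : p ≤ (π.symm i : ℕ) ∧ (π.symm j : ℕ) < p
  · have h2 : ¬ π.symm i < π.symm j := by rw [Fin.lt_def]; omega
    simp [shuffleWord, h, h2]
  · have h2 := h1.resolve_right h
    have h3 : ¬ (shuffleWord p π i = false ∧ shuffleWord p π j = true) := by
      simpa [shuffleWord] using h
    rw [if_pos h2, if_neg h3, Units.val_one]

/-- The letter at a place tells which block its entry comes from, and the count of equal letters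
before it tells which entry of that block it is. -/
theorem shuffleWord_injOn (p : ℕ) : Set.InjOn (shuffleWord (n := n) p) (shuffles n p) := by
  intro π hπ π' hπ' h
  have hsymm : ∀ i, π.symm i = π'.symm i := by
    intro i
    have hc := count_take_shuffleWord p π (r := i) (by omega)
    have hc' := count_take_shuffleWord p π' (r := i) (by omega)
    rw [h] at hc
    have hi := congrFun h i
    simp only [shuffleWord, decide_eq_decide] at hi
    by_cases hlt : (π.symm i : ℕ) < p
    · rw [Fin.ext_iff, ← leftCount_eq hπ hlt, ← leftCount_eq hπ' (hi.mp hlt), ← hc.1, hc'.1]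
    · have hlt' : ¬ (π'.symm i : ℕ) < p := fun h => hlt (hi.mpr h)
      rw [Fin.ext_iff, ← rightCount_eq hπ (not_lt.mp hlt), ← rightCount_eq hπ' (not_lt.mp hlt'),
        ← hc.2, hc'.2]
  rw [← π.symm_symm, ← π'.symm_symm, Equiv.ext hsymm]

theorem exists_shuffleWord_eq {p : ℕ} (w : Fin n → Bool)
    (hw : (List.ofFn w).count true = p) : ∃ π ∈ shuffles n p, shuffleWord p π = w := by
  have hp : p ≤ n := by
    have := (List.ofFn w).count_le_length (a := true)
    rw [List.length_ofFn] at this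
    omega
  obtain ⟨q, rfl⟩ := Nat.exists_eq_add_of_le hp
  rw [count_true_ofFn_eq_card] at hw
  generalize hs : (Finset.univ.filter fun i => w i = true) = s at hw
  have hmem : ∀ i, i ∈ s ↔ w i = true := by simp [← hs]
  have hsc : sᶜ.card = q := by rw [Finset.card_compl, hw]; simp
  -- The first `p` indices enumerate the places of `true` increasingly, the remaining ones enumerate
  -- the complement increasingly.
  let π : Equiv.Perm (Fin (p + q)) := finSumFinEquiv.symm.trans (finSumEquivOfFinset hw hsc)
  have hl : ∀ i : Fin p, π (Fin.castAdd q i) = s.orderEmbOfFin hw i := by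
    intro i; simp [π]
  have hr : ∀ i : Fin q, π (Fin.natAdd p i) = sᶜ.orderEmbOfFin hsc i := by
    intro i; simp [π]
  refine ⟨π, ?_, ?_⟩
  · rw [mem_shuffles]
    intro i j hij h
    induction i using Fin.addCases with
    | left i =>
      induction j using Fin.addCases with
      | left j =>
        rw [hl, hl]
        exact (s.orderEmbOfFin hw).strictMono hij
      | right j =>
        simp only [Fin.val_natAdd, Fin.val_castAdd] at h
        omega
    | right i =>
      induction j using Fin.addCases with
      | left j =>
        rw [Fin.lt_def, Fin.val_natAdd, Fin.val_castAdd] at hij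
        omega
      | right j =>
        rw [hr, hr]
        refine (sᶜ.orderEmbOfFin hsc).strictMono ?_
        rw [Fin.lt_def, Fin.val_natAdd, Fin.val_natAdd] at hij
        rw [Fin.lt_def]
        omega
  · funext i
    obtain ⟨j, rfl⟩ := π.surjective i
    rw [shuffleWord, Equiv.symm_apply_apply]
    induction j using Fin.addCases with
    | left j =>
      rw [hl, (hmem _).mp (s.orderEmbOfFin_mem hw j)]
      simp
    | right j =>
      have := sᶜ.orderEmbOfFin_mem hsc j
      rw [Finset.mem_compl, hmem, Bool.not_eq_true] at this
      rw [hr, this]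
      simp

theorem sum_shuffles {M : Type*} [AddCommGroup M] {p : ℕ} (hp : p ≤ n)
    (F : (Fin n → Bool) → M) :
    ∑ π ∈ shuffles n p, (Equiv.Perm.sign π : ℤ) • F (shuffleWord p π) =
      ∑ w : Fin n → Bool with (List.ofFn w).count true + 1 = p + 1,
        wordSign (List.ofFn w) • F w := by
  refine Finset.sum_nbij (shuffleWord p) ?_ (shuffleWord_injOn p) ?_ ?_
  · intro π _
    simpa using (count_shuffleWord hp π).1
  · intro w hw
    obtain ⟨π, hπ, rfl⟩ := exists_shuffleWord_eq (p := p) w (by simpa using hw)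
    exact ⟨π, hπ, rfl⟩
  · intro π hπ
    rw [sign_eq_wordSign hπ]

theorem card_shuffles {p : ℕ} (hp : p ≤ n) :
    (shuffles n p).card =
      (Finset.univ.filter fun w : Fin n → Bool => (List.ofFn w).count true = p).card := by
  refine Finset.card_nbij (shuffleWord p) ?_ (shuffleWord_injOn p) ?_
  · intro π _
    simpa using (count_shuffleWord hp π).1
  · intro w hw
    obtain ⟨π, hπ, rfl⟩ := exists_shuffleWord_eq (p := p) w (by simpa using hw)
    exact ⟨π, hπ, rfl⟩

/-- Each of the $2^n$ words belongs to exactly one `p`, its number of letters `true`. -/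
theorem sum_card_shuffles (n : ℕ) :
    ∑ p ∈ Finset.range (n + 1), (shuffles n p).card = 2 ^ n := by
  have h : (Finset.univ : Finset (Fin n → Bool)).card =
      ∑ p ∈ Finset.range (n + 1), (Finset.univ.filter
        fun w : Fin n → Bool => (List.ofFn w).count true = p).card := by
    refine Finset.card_eq_sum_card_fiberwise fun w _ => ?_
    have := (List.ofFn w).count_le_length (a := true)
    rw [List.length_ofFn] at this
    simpa [Nat.lt_succ_iff] using this
  rw [Finset.card_univ] at h
  simp only [Fintype.card_pi, Fintype.card_bool, Finset.prod_const, Finset.card_univ,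
    Fintype.card_fin] at h
  rw [h]
  refine Finset.sum_congr rfl fun p hp => card_shuffles ?_
  rw [Finset.mem_range] at hp
  omega

theorem listShuffle_eq_sum_shuffles {V W : Type*} {p : ℕ} (hp : p ≤ n) (u : List V) (v : List W)
    (hu : u.length = p + 1) (hv : p + v.length = n + 1) :
    listShuffle u v = ∑ π ∈ shuffles n p, (Equiv.Perm.sign π : ℤ) •
      Finsupp.single (gridPath (List.ofFn (shuffleWord p π)) u v) (1 : ℤ) := by
  rw [sum_shuffles hp fun w => Finsupp.single (gridPath (List.ofFn w) u v) (1 : ℤ),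
    listShuffle_eq_sum_words (n := n) u v (by omega), hu]

end Shuffles

/-! ### Chains on lists of fixed length. -/

section Homogeneous

/-- Apply a map to the vertices of ordered chains. -/
def mapVertices {V W : Type*} (φ : V → W) : (List V →₀ ℤ) →ₗ[ℤ] (List W →₀ ℤ) :=
  Finsupp.lmapDomain ℤ ℤ (List.map φ)

theorem mapVertices_single {V W : Type*} (φ : V → W) (l : List V) (c : ℤ) :
    mapVertices φ (Finsupp.single l c) = Finsupp.single (l.map φ) c := by
  simp [mapVertices, Finsupp.mapDomain_single]

theorem mapVertices_cylinderEnd {V W : Type*} (φ : V × Bool → W) (b : Bool) (c : List V →₀ ℤ) :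
    mapVertices φ (cylinderEnd b c) = mapVertices (fun v => φ (v, b)) c := by
  suffices h : mapVertices φ ∘ₗ cylinderEnd b = mapVertices (fun v => φ (v, b)) from
    LinearMap.congr_fun h c
  refine Finsupp.lhom_ext' fun l => LinearMap.ext_ring ?_
  simp [cylinderEnd_single, mapVertices_single, Function.comp_def]

theorem listBoundary_mapVertices {V W : Type*} (φ : V → W) (c : List V →₀ ℤ) :
    listBoundary (mapVertices φ c) = mapVertices φ (listBoundary c) := by
  have hcons : ∀ (x : V) (c : List V →₀ ℤ),
      mapVertices φ (consChain x c) = consChain (φ x) (mapVertices φ c) := by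
    intro x c
    suffices h : mapVertices φ ∘ₗ consChain x = consChain (φ x) ∘ₗ mapVertices φ from
      LinearMap.congr_fun h c
    refine Finsupp.lhom_ext' fun l => LinearMap.ext_ring ?_
    simp [mapVertices_single]
  suffices h : listBoundary ∘ₗ mapVertices φ = mapVertices φ ∘ₗ listBoundary from
    LinearMap.congr_fun h c
  refine Finsupp.lhom_ext' fun l => LinearMap.ext_ring ?_
  simp only [LinearMap.comp_apply, Finsupp.lsingle_apply, listBoundary_single, mapVertices_single]
  induction l with
  | nil => simp [alternatingErase]
  | cons x l ih =>
    simp only [List.map_cons, alternatingErase, ih, map_sub, hcons, mapVertices_single]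

/-- The chains on lists of length `n`. -/
def lengthChains (V : Type*) (n : ℕ) : Submodule ℤ (List V →₀ ℤ) :=
  Finsupp.supported ℤ ℤ {l : List V | l.length = n}

theorem single_mem_lengthChains {V : Type*} {n : ℕ} {l : List V} (hl : l.length = n) (c : ℤ) :
    Finsupp.single l c ∈ lengthChains V n :=
  Finsupp.single_mem_supported ℤ c hl

/-- The passage to $BG$ reads a list as an $n$-simplex whatever its length, by truncation or
padding. The identities are therefore needed, and checked, only on lists of the length that fits. -/
theorem linearMap_eq_of_mem_lengthChains {V M : Type*} [AddCommGroup M] {n : ℕ}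
    {A B : (List V →₀ ℤ) →ₗ[ℤ] M}
    (h : ∀ l : List V, l.length = n → A (Finsupp.single l 1) = B (Finsupp.single l 1))
    {c : List V →₀ ℤ} (hc : c ∈ lengthChains V n) : A c = B c := by
  rw [lengthChains, Finsupp.supported_eq_span_single] at hc
  refine LinearMap.eqOn_span (f := A) (g := B) ?_ hc
  rintro _ ⟨l, hl, rfl⟩
  exact h l hl

theorem alternatingErase_eq_sum {V : Type*} (l : List V) :
    alternatingErase l =
      ∑ i ∈ Finset.range l.length, (-1 : ℤ) ^ i • Finsupp.single (l.eraseIdx i) 1 := by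
  induction l with
  | nil => simp [alternatingErase]
  | cons x l ih =>
    simp only [alternatingErase, ih, List.length_cons, Finset.sum_range_succ', map_sum, map_smul,
      consChain_single, pow_succ]
    rw [sub_eq_add_neg, add_comm]
    simp

theorem alternatingErase_mem_lengthChains {V : Type*} {n : ℕ} {l : List V}
    (hl : l.length = n + 1) : alternatingErase l ∈ lengthChains V n := by
  rw [alternatingErase_eq_sum]
  refine Submodule.sum_mem _ fun i hi => Submodule.smul_mem _ _ (single_mem_lengthChains ?_ _)
  rw [Finset.mem_range] at hi
  rw [List.length_eraseIdx_of_lt hi, hl, Nat.add_sub_cancel]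

theorem listPrism_mem_lengthChains {V : Type*} {n : ℕ} {l : List V}
    (hl : l.length = n) : listPrism l ∈ lengthChains (V × Bool) (n + 1) := by
  rw [listPrism_eq_sum]
  refine Submodule.sum_mem _ fun i hi => Submodule.smul_mem _ _ (single_mem_lengthChains ?_ _)
  rw [Finset.mem_range] at hi
  simp only [List.length_append, List.length_map, List.length_take, List.length_drop]
  omega

variable {G : Type u}

/-- The path of pairs of vertices that a shuffle determines on an ordered simplex `l`. -/
def shufflePath {n : ℕ} (p : ℕ) (π : Equiv.Perm (Fin n)) (l : List G) : List (G × G) :=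
  gridPath (List.ofFn (shuffleWord p π)) (l.take (p + 1)) (l.drop p)

variable {n p : ℕ} {π : Equiv.Perm (Fin n)} {l : List G}

theorem length_shufflePath (hp : p ≤ n) (π : Equiv.Perm (Fin n)) (hl : l.length = n + 1) :
    (shufflePath p π l).length = n + 1 := by
  obtain ⟨h1, h2⟩ := count_shuffleWord hp π
  rw [shufflePath, length_gridPath, List.length_ofFn]
  · rw [List.length_take]; omega
  · rw [List.length_drop]; omega

theorem diagonalShuffle_eq_sum_shuffles (hl : l.length = n + 1) :
    diagonalShuffle (Finsupp.single l 1) =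
      ∑ p ∈ Finset.range (n + 1), ∑ π ∈ shuffles n p, (Equiv.Perm.sign π : ℤ) •
        Finsupp.single (shufflePath p π l) (1 : ℤ) := by
  rw [diagonalShuffle_single, hl]
  refine Finset.sum_congr rfl fun p hp => ?_
  rw [Finset.mem_range] at hp
  refine listShuffle_eq_sum_shuffles (by omega) _ _ ?_ ?_
  · rw [List.length_take]; omega
  · rw [List.length_drop]; omega

theorem diagonalShuffle_mem_lengthChains {c : List G →₀ ℤ} (hc : c ∈ lengthChains G (n + 1)) :
    diagonalShuffle c ∈ lengthChains (G × G) (n + 1) := by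
  -- Membership is restated as the vanishing of a linear map into the quotient, so that it can be
  -- tested on single lists.
  have : (lengthChains (G × G) (n + 1)).mkQ (diagonalShuffle c) = 0 := by
    refine linearMap_eq_of_mem_lengthChains
      (A := (lengthChains (G × G) (n + 1)).mkQ ∘ₗ diagonalShuffle) (B := 0) (fun l hl => ?_) hc
    rw [LinearMap.comp_apply, LinearMap.zero_apply, Submodule.mkQ_apply,
      Submodule.Quotient.mk_eq_zero, diagonalShuffle_eq_sum_shuffles hl]
    refine Submodule.sum_mem _ fun p hp => Submodule.sum_mem _ fun π _ =>
      Submodule.smul_mem _ _ (single_mem_lengthChains (length_shufflePath ?_ π hl) _)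
    rw [Finset.mem_range] at hp
    omega
  rwa [Submodule.mkQ_apply, Submodule.Quotient.mk_eq_zero] at this

theorem prism_mem_lengthChains {V : Type*} {c : List V →₀ ℤ} (hc : c ∈ lengthChains V n) :
    prism c ∈ lengthChains (V × Bool) (n + 1) := by
  have : (lengthChains (V × Bool) (n + 1)).mkQ (prism c) = 0 := by
    refine linearMap_eq_of_mem_lengthChains
      (A := (lengthChains (V × Bool) (n + 1)).mkQ ∘ₗ prism) (B := 0) (fun l hl => ?_) hc
    rw [LinearMap.comp_apply, LinearMap.zero_apply, Submodule.mkQ_apply,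
      Submodule.Quotient.mk_eq_zero, prism_single]
    exact listPrism_mem_lengthChains hl
  rwa [Submodule.mkQ_apply, Submodule.Quotient.mk_eq_zero] at this

theorem mapVertices_mem_lengthChains {V W : Type*} (φ : V → W) {c : List V →₀ ℤ}
    (hc : c ∈ lengthChains V n) : mapVertices φ c ∈ lengthChains W n := by
  have : (lengthChains W n).mkQ (mapVertices φ c) = 0 := by
    refine linearMap_eq_of_mem_lengthChains
      (A := (lengthChains W n).mkQ ∘ₗ mapVertices φ) (B := 0) (fun l hl => ?_) hc
    rw [LinearMap.comp_apply, LinearMap.zero_apply, Submodule.mkQ_apply,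
      Submodule.Quotient.mk_eq_zero, mapVertices_single]
    exact single_mem_lengthChains (by simpa using hl) _
  rwa [Submodule.mkQ_apply, Submodule.Quotient.mk_eq_zero] at this

/-! ### Homogeneous coordinates on the classifying space. -/

variable [Group G]

/-- The simplex of `BG` with the homogeneous coordinates `l`. -/
def homogeneousSimplex (n : ℕ) (l : List G) : BSimplex G n :=
  fun i => (l.getD i 1)⁻¹ * l.getD (i + 1) 1

/-- The linear extension of `homogeneousSimplex`. -/
def homogeneousChain (n : ℕ) : (List G →₀ ℤ) →ₗ[ℤ] Chains (BSimplex G n) :=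
  Finsupp.lmapDomain ℤ ℤ (homogeneousSimplex n)

theorem homogeneousChain_single (n : ℕ) (l : List G) (c : ℤ) :
    homogeneousChain n (Finsupp.single l c) = Finsupp.single (homogeneousSimplex n l) c := by
  simp [homogeneousChain, Finsupp.mapDomain_single]

/-- The partial products of the components serve as vertices. -/
theorem exists_homogeneousSimplex_eq (σ : BSimplex G n) :
    ∃ l : List G, l.length = n + 1 ∧ homogeneousSimplex n l = σ := by
  refine ⟨List.ofFn (Fin.partialProd σ), List.length_ofFn, ?_⟩
  funext i
  rw [homogeneousSimplex, List.getD_eq_getElem _ _ (by simp),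
    List.getD_eq_getElem _ _ (by simp), List.getElem_ofFn, List.getElem_ofFn]
  exact Fin.partialProd_right_inv σ i

/-- Erasing an inner vertex multiplies the two adjacent quotients. Reading entries with default
value `1` makes this valid for lists of every length. -/
theorem face_homogeneousSimplex (i : Fin (n + 2)) (l : List G) :
    face i (homogeneousSimplex (n + 1) l) = homogeneousSimplex n (l.eraseIdx i) := by
  have herase : ∀ c : ℕ, (l.eraseIdx i).getD c 1 =
      if c < i then l.getD c 1 else l.getD (c + 1) 1 := by
    intro c
    rw [List.getD_eq_getElem?_getD, List.getElem?_eraseIdx]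
    split_ifs <;> rw [List.getD_eq_getElem?_getD]
  funext c
  simp only [face, homogeneousSimplex, herase, Fin.val_castSucc, Fin.val_succ]
  split_ifs <;> first | rfl | omega | simp [mul_assoc]

theorem boundary_homogeneousChain {c : List G →₀ ℤ} (hc : c ∈ lengthChains G (n + 2)) :
    boundary G n (homogeneousChain (n + 1) c) = homogeneousChain n (listBoundary c) := by
  refine linearMap_eq_of_mem_lengthChains (A := boundary G n ∘ₗ homogeneousChain (n + 1))
    (B := homogeneousChain n ∘ₗ listBoundary) (fun l hl => ?_) hc
  simp only [LinearMap.comp_apply, homogeneousChain_single, listBoundary_single,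
    alternatingErase_eq_sum, hl, map_sum, map_smul, boundary, LinearMap.sum_apply,
    LinearMap.smul_apply, Finsupp.lmapDomain_apply, Finsupp.mapDomain_single,
    face_homogeneousSimplex]
  exact Fin.sum_univ_eq_sum_range
    (fun i => (-1 : ℤ) ^ i • Finsupp.single (homogeneousSimplex n (l.eraseIdx i)) (1 : ℤ)) (n + 2)

theorem getD_map_of_lt {V W : Type*} (φ : V → W) (l : List V) {r : ℕ} (hr : r < l.length)
    (d : V) (d' : W) : (l.map φ).getD r d' = φ (l.getD r d) := by
  rw [List.getD_eq_getElem _ _ (by simpa using hr), List.getD_eq_getElem _ _ hr, List.getElem_map]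

theorem getD_shufflePath (hp : p ≤ n) (π : Equiv.Perm (Fin n)) (hl : l.length = n + 1) {r : ℕ}
    (hr : r ≤ n) : (shufflePath p π l).getD r (1, 1) =
      (l.getD (leftCount p π r) 1, l.getD (p + rightCount p π r) 1) := by
  obtain ⟨h1, h2⟩ := count_shuffleWord hp π
  obtain ⟨h3, h4⟩ := count_take_shuffleWord p π hr
  rw [shufflePath, getD_gridPath, h3, h4]
  · have := leftCount_le p π r
    rw [List.getD_eq_getElem?_getD, List.getElem?_take_of_lt (by omega),
      List.getD_eq_getElem?_getD, List.getElem?_drop, List.getD_eq_getElem?_getD,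
      List.getD_eq_getElem?_getD]
  · rw [List.length_take]; omega
  · rw [List.length_drop]; omega
  · simpa using hr

/-! ### Subdivision and cylinder in homogeneous coordinates. -/

variable {H : Type u} [Group H]

/-- The homogeneous coordinates `g(x_a) f(y_b)` of the simplices of the edgewise subdivision,
after `r` steps along a shuffle. -/
def shuffleVertex (f g : G →* H) (p : ℕ) (π : Equiv.Perm (Fin n)) (l : List G) (r : ℕ) : H :=
  g (l.getD (leftCount p π r) 1) * f (l.getD (p + rightCount p π r) 1)

/-- Consecutive vertices $g(x)f(y)$ differ in one factor. If $f(y)$ changes, the quotient is read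
off directly. If $g(x)$ changes, the quotient is conjugated by $f(y)$, and commutation removes the
conjugation. -/
theorem shuffleSimplex_homogeneousSimplex {f g : G →* H} (hfg : HomsCommute f g)
    (hπ : π ∈ shuffles n p) (l : List G) (i : Fin n) :
    shuffleSimplex f g p π (homogeneousSimplex n l) i =
      (shuffleVertex f g p π l i)⁻¹ * shuffleVertex f g p π l (i + 1) := by
  by_cases h : (π.symm i : ℕ) < p
  · rw [shuffleVertex, shuffleVertex, rightCount_succ_of_lt h, leftCount_succ_of_lt h,
      leftCount_eq hπ h, shuffleSimplex, if_pos h, homogeneousSimplex, map_mul, map_inv, mul_inv_rev]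
    generalize l.getD (p + rightCount p π i) 1 = y
    rw [mul_assoc, eq_inv_mul_iff_mul_eq, ← mul_assoc (g _)⁻¹, ← map_inv, ← map_mul]
    exact hfg _ _
  · rw [not_lt] at h
    rw [shuffleVertex, shuffleVertex, rightCount_succ_of_le h, leftCount_succ_of_le h,
      shuffleSimplex, if_neg (not_lt.mpr h), homogeneousSimplex, ← rightCount_eq hπ h, map_mul,
      map_inv]
    group

/-- The product of consecutive quotients telescopes. -/
theorem prod_drop_take_ofFn_homogeneousSimplex (l : List G) {a b : ℕ} (hab : a ≤ b) (hb : b ≤ n) :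
    (((List.ofFn (homogeneousSimplex n l)).take b).drop a).prod =
      (l.getD a 1)⁻¹ * l.getD b 1 := by
  induction b, hab using Nat.le_induction with
  | base => simp
  | succ b hab ih =>
    have hb' : b < (List.ofFn (homogeneousSimplex n l)).length := by simpa using hb
    rw [List.take_succ_eq_append_getElem hb', List.drop_append_of_le_length, List.prod_append,
      ih (by omega), List.prod_singleton, List.getElem_ofFn, homogeneousSimplex]
    · group
    · rw [List.length_take]; omega

/-- The argument of $m$ telescopes to $x^{-1}y$ for the current pair of vertices $(x,y)$, so each
pillar is the edge from the vertex $k(x)h(y)$ to the vertex $\ell g(x)f(y)$. -/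
theorem pillars_homogeneousSimplex {f g h k : G →* H} {ℓ : H} (hhk : HomsCommute h k)
    (hℓ : ∀ x : G, ℓ * f x * g x = h x * k x * ℓ) (hfg : HomsCommute f g)
    (hp : p ≤ n) (π : Equiv.Perm (Fin n)) (l : List G) (r : Fin (n + 1)) :
    pillars f h ℓ p π (homogeneousSimplex n l) r =
      (shuffleVertex h k p π l r)⁻¹ * (ℓ * shuffleVertex f g p π l r) := by
  have h1 := leftCount_le p π r
  have h2 := leftCount_add_rightCount p π (r := r) (by omega)
  have h3 : p + rightCount p π r ≤ n := by
    have h4 : rightCount p π r ≤ rightCount p π n := Finset.card_le_card fun j => by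
      simp only [Finset.mem_filter, Finset.mem_univ, true_and]
      omega
    have h5 := rightCount_self hp π
    omega
  have h4 : pillars f h ℓ p π (homogeneousSimplex n l) r =
      pillarValue f h ℓ (((List.ofFn (homogeneousSimplex n l)).take
        (p + rightCount p π r)).drop (leftCount p π r)).prod := rfl
  rw [h4, prod_drop_take_ofFn_homogeneousSimplex l (by omega) h3, pillarValue, shuffleVertex,
    shuffleVertex]
  generalize l.getD (leftCount p π r) 1 = x
  generalize l.getD (p + rightCount p π r) 1 = y
  -- This is the hypothesis on `ℓ` at `x`, with `k` and `f` moved across by the two commutation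
  -- relations; it trades `h`, `f` at `x` for `k`, `g`.
  have h5 : h x * ℓ * (f x)⁻¹ = (k x)⁻¹ * ℓ * g x := by
    rw [mul_inv_eq_iff_eq_mul, mul_assoc, mul_assoc, eq_inv_mul_iff_mul_eq, ← mul_assoc,
      ← hhk x x, ← hℓ x, mul_assoc, hfg x x]
  calc (h (x⁻¹ * y))⁻¹ * ℓ * f (x⁻¹ * y) = (h y)⁻¹ * (h x * ℓ * (f x)⁻¹) * f y := by
        simp only [map_mul, map_inv]; group
    _ = (k x * h y)⁻¹ * (ℓ * (g x * f y)) := by rw [h5]; group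

/-- With vertices $A_r$ above and $B_r$ below, both sides of the relation equal $B_r^{-1}\ell
A_{r+1}$. -/
theorem isPillars_shuffle {f g h k : G →* H} {ℓ : H} (hfg : HomsCommute f g)
    (hhk : HomsCommute h k) (hℓ : ∀ x : G, ℓ * f x * g x = h x * k x * ℓ) (hp : p ≤ n)
    (hπ : π ∈ shuffles n p) (σ : BSimplex G n) :
    IsPillars (shuffleSimplex f g p π σ) (shuffleSimplex h k p π σ) (pillars f h ℓ p π σ) := by
  obtain ⟨l, -, rfl⟩ := exists_homogeneousSimplex_eq σ
  intro r
  rw [pillars_homogeneousSimplex hhk hℓ hfg hp, pillars_homogeneousSimplex hhk hℓ hfg hp,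
    shuffleSimplex_homogeneousSimplex hfg hπ, shuffleSimplex_homogeneousSimplex hhk hπ,
    Fin.val_castSucc, Fin.val_succ]
  group

theorem getD_map_shufflePath {V : Type*} (φ : G × G → V) (hp : p ≤ n) (π : Equiv.Perm (Fin n))
    (hl : l.length = n + 1) {r : ℕ} (hr : r ≤ n) (d : V) :
    ((shufflePath p π l).map φ).getD r d =
      φ (l.getD (leftCount p π r) 1, l.getD (p + rightCount p π r) 1) := by
  rw [getD_map_of_lt φ _ (by rw [length_shufflePath hp π hl]; omega) (1, 1),
    getD_shufflePath hp π hl hr]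

/-- The left translation `z` cancels in all quotients. It is kept free because the prism needs `ℓ`
at one end and `1` at the other. -/
theorem homogeneousSimplex_map_shufflePath {f g : G →* H} (hfg : HomsCommute f g) (hp : p ≤ n)
    (hπ : π ∈ shuffles n p) (hl : l.length = n + 1) (z : H) :
    homogeneousSimplex n ((shufflePath p π l).map fun v => z * (g v.1 * f v.2)) =
      shuffleSimplex f g p π (homogeneousSimplex n l) := by
  funext i
  rw [shuffleSimplex_homogeneousSimplex hfg hπ, homogeneousSimplex,
    getD_map_shufflePath _ hp π hl (by omega), getD_map_shufflePath _ hp π hl (by omega)]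
  simp only [shuffleVertex]
  group

/-- The homogeneous coordinates of the cylinder between the two edgewise subdivisions. -/
def cylinderVertex (f g h k : G →* H) (ℓ : H) : (G × G) × Bool → H
  | (v, false) => ℓ * (g v.1 * f v.2)
  | (v, true) => k v.1 * h v.2

theorem homogeneousSimplex_cylinder {f g h k : G →* H} {ℓ : H} (hfg : HomsCommute f g)
    (hhk : HomsCommute h k) (hℓ : ∀ x : G, ℓ * f x * g x = h x * k x * ℓ) (hp : p ≤ n)
    (hπ : π ∈ shuffles n p) (hl : l.length = n + 1) (r : Fin (n + 1)) :
    homogeneousSimplex (n + 1) (((((shufflePath p π l).take (r + 1)).map fun v => (v, true)) ++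
        ((shufflePath p π l).drop r).map fun v => (v, false)).map (cylinderVertex f g h k ℓ)) =
      cylinderSimplex (shuffleSimplex f g p π (homogeneousSimplex n l))
        (shuffleSimplex h k p π (homogeneousSimplex n l))
        (pillars f h ℓ p π (homogeneousSimplex n l)) r := by
  have hlen := length_shufflePath hp π hl
  -- The prism list has `n + 2` vertices and passes twice over the pair at step `r`: places up to
  -- `r` belong to the end `true`, and place `j + 1` with `r ≤ j` carries step `j` at the end
  -- `false`.
  have htop : ∀ j : ℕ, j ≤ r → ((((((shufflePath p π l).take (r + 1)).map fun v => (v, true)) ++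
      ((shufflePath p π l).drop r).map fun v => (v, false)).map
        (cylinderVertex f g h k ℓ)).getD j 1) = shuffleVertex h k p π l j := by
    intro j hj
    have hj' : j < ((shufflePath p π l).take (r + 1)).length := by
      rw [List.length_take, hlen]; omega
    rw [List.map_append, List.getD_append _ _ _ _ (by simpa using hj'), List.map_map,
      getD_map_of_lt _ _ hj' (1, 1), List.getD_eq_getElem?_getD,
      List.getElem?_take_of_lt (by omega), ← List.getD_eq_getElem?_getD,
      getD_shufflePath hp π hl (by omega)]
    rfl
  have hbot : ∀ j : ℕ, r ≤ j → j ≤ n →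
      ((((((shufflePath p π l).take (r + 1)).map fun v => (v, true)) ++
      ((shufflePath p π l).drop r).map fun v => (v, false)).map
        (cylinderVertex f g h k ℓ)).getD (j + 1) 1) = ℓ * shuffleVertex f g p π l j := by
    intro j hj hjn
    have hr : ((shufflePath p π l).take (r + 1)).length = r + 1 := by
      rw [List.length_take, hlen]; omega
    rw [List.map_append, List.getD_append_right _ _ _ _ (by simp only [List.length_map, hr]; omega),
      List.map_map, List.length_map, List.length_map, hr,
      getD_map_of_lt _ _ (by rw [List.length_drop, hlen]; omega) (1, 1),
      List.getD_eq_getElem?_getD, List.getElem?_drop, ← List.getD_eq_getElem?_getD,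
      show (r : ℕ) + (j + 1 - (r + 1)) = j by omega, getD_shufflePath hp π hl hjn]
    rfl
  funext i
  rw [homogeneousSimplex, cylinderSimplex]
  rcases Fin.eq_self_or_eq_succAbove r i with rfl | ⟨j, rfl⟩
  · rw [Fin.insertNth_apply_same, htop _ le_rfl, hbot _ le_rfl (by omega),
      pillars_homogeneousSimplex hhk hℓ hfg hp]
  · rw [Fin.insertNth_apply_succAbove]
    by_cases hj : j.castSucc < r
    · have hj' : (j : ℕ) < r := hj
      rw [if_pos hj, Fin.succAbove_of_castSucc_lt _ _ hj, Fin.val_castSucc, htop _ (by omega),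
        htop _ (by omega), shuffleSimplex_homogeneousSimplex hhk hπ]
    · have hj' : (r : ℕ) ≤ j := not_lt.mp hj
      rw [if_neg hj, Fin.succAbove_of_le_castSucc _ _ (not_lt.mp hj), Fin.val_succ,
        hbot _ hj' (by omega), hbot _ (by omega) (by omega),
        shuffleSimplex_homogeneousSimplex hfg hπ]
      group

/-- The signed sum of the shuffles of a simplex. -/
def shuffleSum (f g : G →* H) (n : ℕ) : Chains (BSimplex G n) →ₗ[ℤ] Chains (BSimplex H n) :=
  Finsupp.linearCombination ℤ fun σ =>
    ∑ p ∈ Finset.range (n + 1), ∑ π ∈ shuffles n p,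
      (Equiv.Perm.sign π : ℤ) • Finsupp.single (shuffleSimplex f g p π σ) (1 : ℤ)

theorem shuffleSum_single (f g : G →* H) (σ : BSimplex G n) :
    shuffleSum f g n (Finsupp.single σ 1) =
      ∑ p ∈ Finset.range (n + 1), ∑ π ∈ shuffles n p,
        (Equiv.Perm.sign π : ℤ) • Finsupp.single (shuffleSimplex f g p π σ) (1 : ℤ) := by
  simp only [shuffleSum, Finsupp.linearCombination_single, one_smul]

theorem shuffleSum_homogeneousChain {f g : G →* H} (hfg : HomsCommute f g) (z : H)
    {c : List G →₀ ℤ} (hc : c ∈ lengthChains G (n + 1)) :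
    shuffleSum f g n (homogeneousChain n c) =
      homogeneousChain n (mapVertices (fun v => z * (g v.1 * f v.2)) (diagonalShuffle c)) := by
  refine linearMap_eq_of_mem_lengthChains (A := shuffleSum f g n ∘ₗ homogeneousChain n)
    (B := homogeneousChain n ∘ₗ mapVertices (fun v : G × G => z * (g v.1 * f v.2)) ∘ₗ diagonalShuffle)
    (fun l hl => ?_) hc
  simp only [LinearMap.comp_apply, homogeneousChain_single, shuffleSum_single,
    diagonalShuffle_eq_sum_shuffles hl, map_sum, map_smul, mapVertices_single]
  refine Finset.sum_congr rfl fun p hp => Finset.sum_congr rfl fun π hπ => ?_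
  rw [Finset.mem_range] at hp
  rw [homogeneousSimplex_map_shufflePath hfg (by omega) hπ hl]

theorem edgewiseCylinder_single (f g h k : G →* H) (ℓ : H) (σ : BSimplex G n) :
    edgewiseCylinder f g h k ℓ n (Finsupp.single σ 1) =
      ∑ p ∈ Finset.range (n + 1), ∑ π ∈ shuffles n p, (Equiv.Perm.sign π : ℤ) •
        cylinder (shuffleSimplex f g p π σ) (shuffleSimplex h k p π σ) (pillars f h ℓ p π σ) := by
  simp only [edgewiseCylinder, Finsupp.linearCombination_single, one_smul]

theorem edgewiseCylinder_homogeneousChain {f g h k : G →* H} {ℓ : H} (hfg : HomsCommute f g)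
    (hhk : HomsCommute h k) (hℓ : ∀ x : G, ℓ * f x * g x = h x * k x * ℓ)
    {c : List G →₀ ℤ} (hc : c ∈ lengthChains G (n + 1)) :
    edgewiseCylinder f g h k ℓ n (homogeneousChain n c) =
      homogeneousChain (n + 1)
        (mapVertices (cylinderVertex f g h k ℓ) (prism (diagonalShuffle c))) := by
  refine linearMap_eq_of_mem_lengthChains
    (A := edgewiseCylinder f g h k ℓ n ∘ₗ homogeneousChain n)
    (B := homogeneousChain (n + 1) ∘ₗ mapVertices (cylinderVertex f g h k ℓ) ∘ₗ prism ∘ₗ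
      diagonalShuffle) (fun l hl => ?_) hc
  simp only [LinearMap.comp_apply, homogeneousChain_single, edgewiseCylinder_single,
    diagonalShuffle_eq_sum_shuffles hl, map_sum, map_smul, prism_single]
  refine Finset.sum_congr rfl fun p hp => Finset.sum_congr rfl fun π hπ => ?_
  have hp' : p ≤ n := by rw [Finset.mem_range] at hp; omega
  rw [cylinder, listPrism_eq_sum, length_shufflePath hp' π hl]
  simp only [map_sum, map_smul, mapVertices_single, homogeneousChain_single]
  rw [← Fin.sum_univ_eq_sum_range (fun r => (-1 : ℤ) ^ r •
    Finsupp.single (homogeneousSimplex (n + 1)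
      (((((shufflePath p π l).take (r + 1)).map fun v => (v, true)) ++
        ((shufflePath p π l).drop r).map fun v => (v, false)).map
          (cylinderVertex f g h k ℓ))) (1 : ℤ))]
  simp only [homogeneousSimplex_cylinder hfg hhk hℓ hp' hπ hl]

theorem boundary_homogeneousSimplex (l : List G) (hl : l.length = n + 2) :
    boundary G n (Finsupp.single (homogeneousSimplex (n + 1) l) 1) =
      homogeneousChain n (alternatingErase l) := by
  rw [← homogeneousChain_single, boundary_homogeneousChain (single_mem_lengthChains hl 1),
    listBoundary_single]

theorem boundary_shuffleSum {f g : G →* H} (hfg : HomsCommute f g) (n : ℕ) :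
    boundary H n ∘ₗ shuffleSum f g (n + 1) = shuffleSum f g n ∘ₗ boundary G n := by
  refine Finsupp.lhom_ext' fun σ => LinearMap.ext_ring ?_
  obtain ⟨l, hl, rfl⟩ := exists_homogeneousSimplex_eq σ
  have hmem := single_mem_lengthChains hl 1
  simp only [LinearMap.comp_apply, Finsupp.lsingle_apply]
  rw [boundary_homogeneousSimplex l hl, shuffleSum_homogeneousChain hfg 1
    (alternatingErase_mem_lengthChains hl), ← homogeneousChain_single,
    shuffleSum_homogeneousChain hfg 1 hmem, boundary_homogeneousChain
      (mapVertices_mem_lengthChains _ (diagonalShuffle_mem_lengthChains hmem)),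
    listBoundary_mapVertices, listBoundary_diagonalShuffle (by omega)]

theorem edgewiseCylinder_homotopy {f g h k : G →* H} {ℓ : H} (hfg : HomsCommute f g)
    (hhk : HomsCommute h k) (hℓ : ∀ x : G, ℓ * f x * g x = h x * k x * ℓ) (n : ℕ) :
    boundary H (n + 1) ∘ₗ edgewiseCylinder f g h k ℓ (n + 1) +
      edgewiseCylinder f g h k ℓ n ∘ₗ boundary G n =
    shuffleSum f g (n + 1) - shuffleSum h k (n + 1) := by
  refine Finsupp.lhom_ext' fun σ => LinearMap.ext_ring ?_
  obtain ⟨l, hl, rfl⟩ := exists_homogeneousSimplex_eq σ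
  have hmem := single_mem_lengthChains hl 1
  have hK := diagonalShuffle_mem_lengthChains hmem
  simp only [LinearMap.comp_apply, LinearMap.add_apply, LinearMap.sub_apply,
    Finsupp.lsingle_apply]
  -- Everything is carried to ordered chains, with translation `ℓ` for `f`, `g` and `1` for `h`, `k`
  -- as in `cylinderVertex`; there the claim is the prism formula applied to the subdivided simplex.
  rw [boundary_homogeneousSimplex l hl, edgewiseCylinder_homogeneousChain hfg hhk hℓ
    (alternatingErase_mem_lengthChains hl), ← homogeneousChain_single,
    shuffleSum_homogeneousChain hfg ℓ hmem, shuffleSum_homogeneousChain hhk 1 hmem,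
    edgewiseCylinder_homogeneousChain hfg hhk hℓ hmem,
    boundary_homogeneousChain (mapVertices_mem_lengthChains _ (prism_mem_lengthChains hK)),
    listBoundary_mapVertices, ← listBoundary_diagonalShuffle (by omega), ← map_add, ← map_add,
    listBoundary_prism, map_sub, map_sub, mapVertices_cylinderEnd, mapVertices_cylinderEnd]
  simp only [cylinderVertex, one_mul]

end Homogeneous

/-! ### The composite through Alexander–Whitney and Eilenberg–Zilber as a sum of shuffles. -/

section EilenbergZilber

variable {H : Type u} [Group H]

theorem frontFace_apply {p : ℕ} (q : ℕ) (σ : BSimplex H (p + q)) (i : Fin p) :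
    frontFace q σ i = σ (Fin.castAdd q i) := by
  induction q with
  | zero => rfl
  | succ q ih =>
    rw [frontFace, ih, face]
    have : ((Fin.castAdd q i : Fin (p + q)) : ℕ) + 1 < (Fin.last (p + q + 1) : ℕ) := by
      rw [Fin.val_castAdd, Fin.val_last]; omega
    rw [if_pos this]
    rfl

theorem backFace_apply {q : ℕ} (p : ℕ) (σ : BSimplex H (q + p)) (i : Fin q) :
    backFace p σ i = σ (Fin.addNat i p) := by
  induction p with
  | zero => rfl
  | succ p ih =>
    rw [backFace, ih, face, if_neg (by simp), if_neg (by simp)]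
    rfl

theorem degen_apply {n : ℕ} (i : Fin (n + 1)) (σ : BSimplex H n) (c : Fin (n + 1)) :
    degen i σ c = if h : (c : ℕ) < i then σ ⟨c, by omega⟩
      else if h' : (c : ℕ) = i then 1 else σ ⟨c - 1, by omega⟩ := by
  rw [degen]
  rcases Fin.eq_self_or_eq_succAbove i c with rfl | ⟨j, rfl⟩
  · simp
  · rw [Fin.insertNth_apply_succAbove]
    by_cases hj : j.castSucc < i
    · have hj' : (j : ℕ) < i := hj
      simp [Fin.succAbove_of_castSucc_lt _ _ hj, hj']
    · have hj' : (i : ℕ) ≤ j := not_lt.mp hj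
      have h1 : ¬ (j : ℕ) + 1 < i := by omega
      have h2 : ¬ (j : ℕ) + 1 = i := by omega
      simp [Fin.succAbove_of_le_castSucc _ _ (not_lt.mp hj), h1, h2]

/-- Because the indices increase, each degeneracy inserts its unit beyond those inserted before and
does not move them; the units end at exactly the places `ν j`. -/
theorem iterDegen_apply_of_mem {p : ℕ} (q : ℕ) (ν : Fin q → ℕ) (hν : StrictMono ν)
    (hlt : ∀ j, ν j < p + q) (σ : BSimplex H p) (i : Fin (p + q)) (hi : ∃ j, ν j = i) :
    iterDegen q ν σ i = 1 := by
  induction q with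
  | zero => obtain ⟨j, -⟩ := hi; exact j.elim0
  | succ q ih =>
    obtain ⟨j, hj⟩ := hi
    have hlast : ((Fin.ofNat (p + q + 1) (ν (Fin.last q)) : Fin (p + q + 1)) : ℕ) =
        ν (Fin.last q) := by
      exact Nat.mod_eq_of_lt (hlt (Fin.last q))
    rw [iterDegen, degen_apply]
    simp only [hlast]
    induction j using Fin.lastCases with
    | last => simp [hj]
    | cast j =>
      have h1 : ν j.castSucc < ν (Fin.last q) := hν (Fin.castSucc_lt_last j)
      rw [dif_pos (by omega)]
      refine ih _ (fun a b hab => hν hab) (fun j' => ?_) _ ⟨j, hj⟩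
      have h2 : ν j'.castSucc < ν (Fin.last q) := hν (Fin.castSucc_lt_last j')
      have := hlt (Fin.last q)
      omega

theorem iterDegen_apply_of_notMem {p : ℕ} (q : ℕ) (ν : Fin q → ℕ) (hν : StrictMono ν)
    (hlt : ∀ j, ν j < p + q) (σ : BSimplex H p) (i : Fin (p + q)) (hi : ∀ j, ν j ≠ i)
    (a : Fin p) (ha : (a : ℕ) + (Finset.univ.filter fun j => ν j < i).card = i) :
    iterDegen q ν σ i = σ a := by
  induction q with
  | zero =>
    rw [iterDegen]
    congr 1
    ext
    simpa using ha.symm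
  | succ q ih =>
    have hlast : ((Fin.ofNat (p + q + 1) (ν (Fin.last q)) : Fin (p + q + 1)) : ℕ) =
        ν (Fin.last q) := by
      exact Nat.mod_eq_of_lt (hlt (Fin.last q))
    have h2 : ∀ j' : Fin q, ν j'.castSucc < ν (Fin.last q) := fun j' =>
      hν (Fin.castSucc_lt_last j')
    have hlt' : ∀ j' : Fin q, ν j'.castSucc < p + q := fun j' => by
      have := hlt (Fin.last q)
      have := h2 j'
      omega
    rw [Finset.card_filter, Fin.sum_univ_castSucc, ← Finset.card_filter] at ha
    rw [iterDegen, degen_apply]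
    simp only [hlast]
    have h3 := hi (Fin.last q)
    rcases lt_or_gt_of_ne h3 with h | h
    · rw [if_pos h] at ha
      -- Beyond the last inserted unit the entry comes from the preceding place of the previous
      -- simplex, and all earlier units lie before that place as well.
      rw [dif_neg (by omega), dif_neg (by omega)]
      refine ih _ (fun a b hab => hν hab) hlt' _ (fun j => ?_) ?_
      · have := h2 j
        simp only
        omega
      · have h4 : (Finset.univ.filter fun j : Fin q => ν j.castSucc < i) = Finset.univ :=
          Finset.filter_true_of_mem fun j _ => (h2 j).trans h
        have h5 : (Finset.univ.filter fun j : Fin q => ν j.castSucc < (i : ℕ) - 1) =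
            Finset.univ := Finset.filter_true_of_mem fun j _ => by have := h2 j; omega
        rw [h4] at ha
        simp only [h5]
        omega
    · rw [if_neg (by omega), add_zero] at ha
      rw [dif_pos h]
      exact ih _ (fun a b hab => hν hab) hlt' _ (fun j => hi _) ha

theorem card_filter_natAdd {n p q : ℕ} (e : p + q = n) (π : Equiv.Perm (Fin n)) (r : ℕ) :
    (Finset.univ.filter fun j : Fin q => (π ⟨p + j, by omega⟩).val < r).card =
      rightCount p π r := by
  refine Finset.card_nbij (fun j : Fin q => (⟨p + j, by omega⟩ : Fin n)) ?_ ?_ ?_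
  · intro j hj
    simp only [Finset.coe_filter, Finset.mem_univ, true_and, Set.mem_ofPred_eq] at hj ⊢
    exact ⟨by omega, hj⟩
  · intro j _ j' _ h
    simpa [Fin.ext_iff] using h
  · intro j hj
    simp only [Finset.coe_filter, Finset.mem_univ, true_and, Set.mem_ofPred_eq] at hj
    refine ⟨⟨j - p, by omega⟩, ?_, ?_⟩
    · have : (⟨p + (j - p), by omega⟩ : Fin n) = j := Fin.ext (by simp only; omega)
      simpa [this] using hj.2
    · exact Fin.ext (by simp only; omega)

theorem card_filter_castAdd {n p q : ℕ} (e : p + q = n) (π : Equiv.Perm (Fin n)) (r : ℕ) :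
    (Finset.univ.filter fun j : Fin p => (π ⟨j, by omega⟩).val < r).card =
      leftCount p π r := by
  refine Finset.card_nbij (fun j : Fin p => (⟨j, by omega⟩ : Fin n)) ?_ ?_ ?_
  · intro j hj
    simp only [Finset.coe_filter, Finset.mem_univ, true_and, Set.mem_ofPred_eq] at hj ⊢
    exact ⟨by omega, hj⟩
  · intro j _ j' _ h
    simpa [Fin.ext_iff] using h
  · intro j hj
    simp only [Finset.coe_filter, Finset.mem_univ, true_and, Set.mem_ofPred_eq] at hj
    exact ⟨⟨j, hj.1⟩, by simpa using hj.2, rfl⟩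

/-- The components of the product of the two simplices that the shuffle map associates with the
front face of `σ` and the back face of `τ`. -/
theorem shuffleProduct_frontFace_backFace {n p q : ℕ} (e : p + q = n) {π : Equiv.Perm (Fin n)}
    (hπ : π ∈ shuffles n p) (σ τ : BSimplex H n) (i : Fin n) :
    (shuffleProduct e π (frontFace q (recast e.symm σ))
        (backFace p (recast ((Nat.add_comm q p).trans e).symm τ))).1 i *
      (shuffleProduct e π (frontFace q (recast e.symm σ))
        (backFace p (recast ((Nat.add_comm q p).trans e).symm τ))).2 i =
      if (π.symm i : ℕ) < p then σ (π.symm i) else τ (π.symm i) := by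
  -- The two blocks of places are complementary, so at every place exactly one of the two factors is
  -- a degenerate unit; monotonicity on each block is what the degeneracy lemmas require.
  have hmono := mem_shuffles.mp hπ
  have hν : StrictMono fun j : Fin q => (π ⟨p + j, by omega⟩).val := fun a b hab => by
    have hab' : (a : ℕ) < b := hab
    exact hmono _ _ (Fin.lt_def.mpr (by simp only; omega)) (Or.inr (by simp))
  have hμ : StrictMono fun j : Fin p => (π ⟨j, by omega⟩).val := fun a b hab =>
    hmono _ _ (Fin.lt_def.mpr hab) (Or.inl b.isLt)
  have hsum := leftCount_add_rightCount p π (r := i) (by omega)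
  simp only [shuffleProduct]
  rw [recast, recast]
  by_cases h : (π.symm i : ℕ) < p
  · have hl := leftCount_eq hπ h
    rw [if_pos h, iterDegen_apply_of_notMem q _ hν (fun j => by omega) _ _ ?_
      ⟨π.symm i, h⟩ ?_, iterDegen_apply_of_mem p _ hμ (fun j => by omega) _ _
        ⟨⟨π.symm i, h⟩, by simp⟩, mul_one, frontFace_apply]
    · rfl
    · intro j hj
      have : (⟨p + j, by omega⟩ : Fin n) = π.symm i := by
        rw [Equiv.eq_symm_apply]
        exact Fin.ext hj
      rw [← this] at h
      simp at h
    · simp only [Fin.val_cast]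
      rw [card_filter_natAdd e]
      omega
  · rw [not_lt] at h
    have hl := rightCount_eq hπ h
    rw [if_neg (not_lt.mpr h), iterDegen_apply_of_mem q _ hν (fun j => by omega) _ _
      ⟨⟨π.symm i - p, by omega⟩, ?_⟩, iterDegen_apply_of_notMem p _ hμ (fun j => by omega) _ _
        ?_ ⟨π.symm i - p, by omega⟩ ?_, one_mul, backFace_apply, recast]
    · congr 1
      ext
      simp only [Fin.val_cast, Fin.val_addNat]
      omega
    · intro j hj
      have : (⟨j, by omega⟩ : Fin n) = π.symm i := by
        rw [Equiv.eq_symm_apply]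
        exact Fin.ext hj
      rw [← this] at h
      simp only at h
      omega
    · simp only [Fin.val_cast]
      rw [card_filter_castAdd e]
      omega
    · have : (⟨p + (π.symm i - p), by omega⟩ : Fin n) = π.symm i :=
        Fin.ext (by simp only; omega)
      simp [this]

theorem edgewise_single {G : Type u} [Group G] (f g : G →* H) {n : ℕ} (σ : BSimplex G n) :
    edgewise f g n (Finsupp.single σ 1) =
      ∑ p ∈ Finset.range (n + 1), ∑ π ∈ shuffles n p,
        (Equiv.Perm.sign π : ℤ) • Finsupp.single (shuffleSimplex f g p π σ) (1 : ℤ) := by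
  rw [← Finset.Nat.sum_antidiagonal_eq_sum_range_succ_mk
    (f := fun x : ℕ × ℕ => ∑ π ∈ shuffles n x.1,
      (Equiv.Perm.sign π : ℤ) • Finsupp.single (shuffleSimplex f g x.1 π σ) (1 : ℤ)),
    ← Finset.sum_coe_sort]
  simp only [edgewise, LinearMap.comp_apply, diagonalMap, pairMap, Finsupp.lmapDomain_apply,
    Finsupp.mapDomain_single, alexanderWhitney, Finsupp.linearCombination_single, one_smul,
    map_sum]
  refine Finset.sum_congr rfl fun pq _ => ?_
  rw [eilenbergZilber, DirectSum.toModule_lof]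
  change multMap H n (Finsupp.linearCombination ℤ _ (finsuppTensorFinsupp' ℤ _ _
    (Finsupp.single _ 1 ⊗ₜ[ℤ] Finsupp.single _ 1))) = _
  rw [finsuppTensorFinsupp'_single_tmul_single, mul_one, Finsupp.linearCombination_single, one_smul,
    map_sum]
  refine Finset.sum_congr rfl fun π hπ => ?_
  rw [map_smul, multMap, Finsupp.lmapDomain_apply, Finsupp.mapDomain_single]
  congr 2
  funext i
  rw [shuffleProduct_frontFace_backFace _ hπ, shuffleSimplex]

theorem edgewise_eq_shuffleSum {G : Type u} [Group G] (f g : G →* H) (n : ℕ) :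
    edgewise f g n = shuffleSum f g n := by
  refine Finsupp.lhom_ext' fun σ => LinearMap.ext_ring ?_
  simp only [LinearMap.comp_apply, Finsupp.lsingle_apply]
  rw [edgewise_single, shuffleSum_single]

end EilenbergZilber

/-! ### Diameters of signed sums and cancellation. -/

section Diameter

theorem diameter_eq_sum_of_support_subset {X : Type u} (c : Chains X) {s : Finset X}
    (hs : c.support ⊆ s) : diameter c = ∑ y ∈ s, (c y).natAbs :=
  Finsupp.sum_of_support_subset c hs _ fun _ _ => rfl

theorem diameter_add_le {X : Type u} (c d : Chains X) :
    diameter (c + d) ≤ diameter c + diameter d := by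
  classical
  rw [diameter_eq_sum_of_support_subset _ Finsupp.support_add,
    diameter_eq_sum_of_support_subset c Finset.subset_union_left,
    diameter_eq_sum_of_support_subset d Finset.subset_union_right, ← Finset.sum_add_distrib]
  exact Finset.sum_le_sum fun y _ => Int.natAbs_add_le _ _

theorem diameter_single {X : Type u} (x : X) (a : ℤ) :
    diameter (Finsupp.single x a) = a.natAbs := by
  simp [diameter, Finsupp.sum_single_index]

theorem diameter_signedSum_le {X : Type u} {ι : Type*} (s : Finset ι) (ε : ι → ℤ) (x : ι → X)
    (hε : ∀ i ∈ s, (ε i).natAbs = 1) :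
    diameter (∑ i ∈ s, ε i • Finsupp.single (x i) (1 : ℤ)) ≤ s.card := by
  classical
  induction s using Finset.induction_on with
  | empty => simp [diameter]
  | insert i s hi ih =>
    rw [Finset.sum_insert hi, Finset.card_insert_of_notMem hi, add_comm s.card]
    refine (diameter_add_le _ _).trans (Nat.add_le_add ?_ (ih fun j hj =>
      hε j (Finset.mem_insert_of_mem hj)))
    rw [Finsupp.smul_single, smul_eq_mul, mul_one, diameter_single,
      hε i (Finset.mem_insert_self i s)]

/-- Two equal simplices with opposite signs can be struck out, which lowers the bound by two.
Without such pairs, each coefficient is the size of a fibre of `x` up to sign, and the fibres add up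
to the whole index set. -/
theorem diameter_signedSum_eq_card_iff {X : Type u} {ι : Type*} (s : Finset ι) (ε : ι → ℤ)
    (x : ι → X) (hε : ∀ i ∈ s, (ε i).natAbs = 1) :
    diameter (∑ i ∈ s, ε i • Finsupp.single (x i) (1 : ℤ)) = s.card ↔
      ∀ i ∈ s, ∀ j ∈ s, x i = x j → ε i = ε j := by
  classical
  constructor
  · intro h i hi j hj hx
    by_contra hne
    have hij : j ≠ i := fun hij => hne (by rw [hij])
    have hj' : j ∈ s.erase i := Finset.mem_erase.mpr ⟨hij, hj⟩
    have h0 : ε i + ε j = 0 := by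
      have h1 := hε i hi
      have h2 := hε j hj
      omega
    have hle := diameter_signedSum_le ((s.erase i).erase j) ε x fun l hl =>
      hε l (Finset.mem_of_mem_erase (Finset.mem_of_mem_erase hl))
    rw [← Finset.add_sum_erase s _ hi, ← Finset.add_sum_erase _ _ hj', hx, ← add_assoc,
      ← add_smul, h0, zero_smul, zero_add] at h
    have h1 := Finset.card_erase_add_one hi
    have h2 := Finset.card_erase_add_one hj'
    omega
  · intro h
    have hval : ∀ y, (∑ i ∈ s, ε i • Finsupp.single (x i) (1 : ℤ)) y =
        ∑ i ∈ s with x i = y, ε i := by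
      intro y
      rw [Finsupp.finsetSum_apply, Finset.sum_filter]
      refine Finset.sum_congr rfl fun i _ => ?_
      simp [Finsupp.single_apply]
    have hsupp : (∑ i ∈ s, ε i • Finsupp.single (x i) (1 : ℤ)).support ⊆ s.image x := by
      intro y hy
      rw [Finsupp.mem_support_iff, hval] at hy
      obtain ⟨i, hi, -⟩ := Finset.exists_ne_zero_of_sum_ne_zero hy
      rw [Finset.mem_filter] at hi
      exact Finset.mem_image.mpr ⟨i, hi.1, hi.2⟩
    rw [diameter_eq_sum_of_support_subset _ hsupp, Finset.card_eq_sum_card_image x s]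
    refine Finset.sum_congr rfl fun y hy => ?_
    obtain ⟨i, hi, rfl⟩ := Finset.mem_image.mp hy
    rw [hval, Finset.sum_congr rfl (g := fun _ => ε i) fun j hj => ?_, Finset.sum_const,
      nsmul_eq_mul, Int.natAbs_mul, hε i hi, mul_one, Int.natAbs_natCast]
    rw [Finset.mem_filter] at hj
    exact h j hj.1 i hi hj.2

theorem cylinderSimplex_self {H : Type u} {n : ℕ} (a b : BSimplex H n) (t : Fin (n + 1) → H)
    (r : Fin (n + 1)) : cylinderSimplex a b t r r = t r := by
  rw [cylinderSimplex, Fin.insertNth_apply_same]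

theorem cylinderSimplex_of_lt {H : Type u} {n : ℕ} (a b : BSimplex H n) (t : Fin (n + 1) → H)
    {i r : Fin (n + 1)} (h : i < r) :
    cylinderSimplex a b t r i = b ⟨i, by omega⟩ := by
  have hj : (⟨i, by omega⟩ : Fin n).castSucc = i := rfl
  conv_lhs => rw [← hj, ← Fin.succAbove_of_castSucc_lt r ⟨i, by omega⟩ h]
  rw [cylinderSimplex, Fin.insertNth_apply_succAbove, if_pos (by rw [hj]; exact h)]

variable {G H : Type u} [Group G] [Group H]

/-- The index set of the simplices that occur in the edgewise cylinder. -/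
def cylinderIndex (n : ℕ) : Finset (Σ _ : ℕ, Equiv.Perm (Fin n) × Fin (n + 1)) :=
  (Finset.range (n + 1)).sigma fun p => shuffles n p ×ˢ Finset.univ

theorem sum_shuffles_const (n : ℕ) :
    ∑ p ∈ Finset.range (n + 1), ∑ _π ∈ shuffles n p, (n + 1) = 2 ^ n * (n + 1) := by
  simp only [Finset.sum_const, smul_eq_mul, ← Finset.sum_mul, sum_card_shuffles]

theorem card_cylinderIndex (n : ℕ) : (cylinderIndex n).card = 2 ^ n * (n + 1) := by
  rw [cylinderIndex, Finset.card_sigma, ← sum_shuffles_const]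
  simp [Finset.card_product]

theorem edgewiseCylinder_eq_signedSum (f g h k : G →* H) (ℓ : H) {n : ℕ} (σ : BSimplex G n) :
    edgewiseCylinder f g h k ℓ n (Finsupp.single σ 1) =
      ∑ i ∈ cylinderIndex n, ((Equiv.Perm.sign i.2.1 : ℤ) * (-1) ^ (i.2.2 : ℕ)) •
        Finsupp.single (cylinderSimplex (shuffleSimplex f g i.1 i.2.1 σ)
          (shuffleSimplex h k i.1 i.2.1 σ) (pillars f h ℓ i.1 i.2.1 σ) i.2.2) (1 : ℤ) := by
  rw [edgewiseCylinder_single, cylinderIndex, Finset.sum_sigma]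
  refine Finset.sum_congr rfl fun p _ => ?_
  rw [Finset.sum_product]
  refine Finset.sum_congr rfl fun π _ => ?_
  simp only [cylinder, Finset.smul_sum, smul_smul]

theorem natAbs_sign_mul_neg_one_pow {n : ℕ} (π : Equiv.Perm (Fin n)) (r : ℕ) :
    ((Equiv.Perm.sign π : ℤ) * (-1) ^ r).natAbs = 1 := by
  rw [Int.natAbs_mul, Int.natAbs_pow, Int.units_natAbs]
  simp

theorem diameter_edgewiseCylinder_le (f g h k : G →* H) (ℓ : H) {n : ℕ} (σ : BSimplex G n) :
    diameter (edgewiseCylinder f g h k ℓ n (Finsupp.single σ 1)) ≤ 2 ^ n * (n + 1) := by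
  rw [edgewiseCylinder_eq_signedSum, ← card_cylinderIndex]
  exact diameter_signedSum_le _ _ _ fun i _ => natAbs_sign_mul_neg_one_pow _ _

theorem diameter_edgewiseCylinder_eq_iff (f g h k : G →* H) (ℓ : H) {n : ℕ} (σ : BSimplex G n) :
    diameter (edgewiseCylinder f g h k ℓ n (Finsupp.single σ 1)) = 2 ^ n * (n + 1) ↔
      NoCancellation f g h k ℓ σ := by
  rw [edgewiseCylinder_eq_signedSum, ← card_cylinderIndex,
    diameter_signedSum_eq_card_iff _ _ _ fun i _ => natAbs_sign_mul_neg_one_pow _ _]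
  simp only [cylinderIndex, Finset.mem_sigma, Finset.mem_product, Finset.mem_univ, and_true,
    NoCancellation]
  constructor
  · intro H p hp π hπ r p' hp' π' hπ' r' hs
    exact H ⟨p, π, r⟩ ⟨hp, hπ⟩ ⟨p', π', r'⟩ ⟨hp', hπ'⟩ hs
  · intro H i hi j hj hs
    exact H _ hi.1 _ hi.2 _ _ hj.1 _ hj.2 _ hs

/-- Before the pillar all entries lie in $\{h(x),k(x)\}$ and the pillar does not, so its place is
determined. The other entries then spell the word of the shuffle, as `f`, `g` and `h`, `k` differ at
`x`. Hence no two terms coincide at all. -/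
theorem noCancellation_const {f g h k : G →* H} {ℓ : H} {n : ℕ} {x : G} (hfg : f x ≠ g x)
    (hhk : h x ≠ k x) (hm : ∀ j : ℕ, j ≤ n →
      pillarValue f h ℓ (x ^ j) ≠ h x ∧ pillarValue f h ℓ (x ^ j) ≠ k x) :
    NoCancellation f g h k ℓ (fun _ : Fin n => x) := by
  have hpillar : ∀ (p : ℕ) (π : Equiv.Perm (Fin n)) (r : Fin (n + 1)),
      pillars f h ℓ p π (fun _ => x) r ≠ h x ∧ pillars f h ℓ p π (fun _ => x) r ≠ k x := by
    intro p π r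
    -- On a constant simplex the argument of $m$ is the product of a segment of at most `n` copies
    -- of `x`.
    have : ∃ j ≤ n, pillars f h ℓ p π (fun _ => x) r = pillarValue f h ℓ (x ^ j) := by
      simp only [pillars, List.ofFn_const, List.take_replicate, List.drop_replicate,
        List.prod_replicate]
      exact ⟨_, (Nat.sub_le _ _).trans (min_le_right _ _), rfl⟩
    obtain ⟨j, hj, hj'⟩ := this
    rw [hj']
    exact hm j hj
  have hle : ∀ {p p' : ℕ} {π π' : Equiv.Perm (Fin n)} {r r' : Fin (n + 1)},
      cylinderSimplex (shuffleSimplex f g p π fun _ => x) (shuffleSimplex h k p π fun _ => x)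
        (pillars f h ℓ p π fun _ => x) r =
      cylinderSimplex (shuffleSimplex f g p' π' fun _ => x) (shuffleSimplex h k p' π' fun _ => x)
        (pillars f h ℓ p' π' fun _ => x) r' → r' ≤ r := by
    intro p p' π π' r r' hs
    by_contra! hlt
    have h1 := congrFun hs r
    rw [cylinderSimplex_self, cylinderSimplex_of_lt _ _ _ hlt, shuffleSimplex] at h1
    split_ifs at h1
    · exact (hpillar p π r).2 h1
    · exact (hpillar p π r).1 h1
  intro p hp π hπ r p' hp' π' hπ' r' hs
  obtain rfl : r = r' := le_antisymm (hle hs.symm) (hle hs)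
  have hword : shuffleWord p π = shuffleWord p' π' := by
    funext j
    rw [shuffleWord, shuffleWord, decide_eq_decide]
    have h1 := congrFun hs (r.succAbove j)
    simp only [cylinderSimplex, Fin.insertNth_apply_succAbove, shuffleSimplex] at h1
    split_ifs at h1 with h2 h3 h4 h4 h3 h4 h4 <;>
      first
      | exact iff_of_true ‹_› ‹_›
      | exact iff_of_false ‹_› ‹_›
      | exact absurd h1 hhk
      | exact absurd h1.symm hhk
      | exact absurd h1 hfg
      | exact absurd h1.symm hfg
  rw [Finset.mem_range] at hp hp'
  obtain rfl : p = p' := by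
    rw [← (count_shuffleWord (p := p) (by omega) π).1, hword,
      (count_shuffleWord (p := p') (by omega) π').1]
  rw [shuffleWord_injOn p hπ hπ' hword]

end Diameter

/-! ### Chain maps, chain homotopies and diameter functions. -/

section ChainComplexes

variable {G H : Type u} [Group G] [Group H]

theorem moore_d (G : Type u) [Group G] (n : ℕ) :
    (moore G).d (n + 1) n = ModuleCat.ofHom (boundary G n) :=
  ChainComplex.of_d (fun n => ModuleCat.of ℤ (Chains (BSimplex G n)))
    (fun n => ModuleCat.ofHom (boundary G n)) n

/-- Both faces of a $1$-simplex are the unique $0$-simplex. This is what leaves the value of the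
homotopy in degree `0` free. -/
theorem boundary_zero (G : Type u) [Group G] : boundary G 0 = 0 := by
  refine Finsupp.lhom_ext' fun σ => LinearMap.ext_ring ?_
  simp [boundary, Fin.sum_univ_two, Finsupp.mapDomain_single,
    Subsingleton.elim (face 1 σ) (face 0 σ)]

theorem moore_d_zero (G : Type u) [Group G] : (moore G).d (0 + 1) 0 = 0 :=
  (moore_d G 0).trans (congrArg ModuleCat.ofHom (boundary_zero G))

/-- The edgewise subdivision as a morphism of chain complexes. -/
def edgewiseMap (f g : G →* H) (hfg : HomsCommute f g) : moore G ⟶ moore H :=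
  ChainComplex.ofHom (fun n => ModuleCat.ofHom (edgewise f g n)) fun n => by
    rw [moore_d, moore_d]
    refine (ModuleCat.ofHom_comp _ _).symm.trans (Eq.trans ?_ (ModuleCat.ofHom_comp _ _))
    rw [edgewise_eq_shuffleSum, edgewise_eq_shuffleSum, boundary_shuffleSum hfg]

theorem isEdgewise_edgewiseMap (f g : G →* H) (hfg : HomsCommute f g) :
    IsEdgewise f g (edgewiseMap f g hfg) := fun _ => rfl

/-- The edgewise cylinder, multiplied by `c` in degree `0`. -/
def scaledCylinder (f g h k : G →* H) (ℓ : H) (c : ℤ) (n : ℕ) :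
    Chains (BSimplex G n) →ₗ[ℤ] Chains (BSimplex H (n + 1)) :=
  (if n = 0 then c else 1) • edgewiseCylinder f g h k ℓ n

theorem scaledCylinder_succ (f g h k : G →* H) (ℓ : H) (c : ℤ) (n : ℕ) :
    scaledCylinder f g h k ℓ c (n + 1) = edgewiseCylinder f g h k ℓ (n + 1) := by
  rw [scaledCylinder, if_neg (Nat.succ_ne_zero n), one_smul]

/-- The scalar affects only degree `0`, where the incoming boundary is zero; the homotopy identity
in higher degrees does not see it. -/
theorem scaledCylinder_comp_boundary (f g h k : G →* H) (ℓ : H) (c : ℤ) (n : ℕ) :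
    scaledCylinder f g h k ℓ c n ∘ₗ boundary G n =
      edgewiseCylinder f g h k ℓ n ∘ₗ boundary G n := by
  cases n with
  | zero => rw [boundary_zero, LinearMap.comp_zero, LinearMap.comp_zero]
  | succ n => rw [scaledCylinder_succ]

theorem edgewiseCylinder_zero (f g h k : G →* H) (ℓ : H) (σ : BSimplex G 0) :
    edgewiseCylinder f g h k ℓ 0 (Finsupp.single σ 1) = Finsupp.single (fun _ => ℓ) 1 := by
  have hsh : shuffles 0 0 = {1} := by
    ext π
    simp [shuffles, Subsingleton.elim π 1]
  rw [edgewiseCylinder_single]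
  simp only [zero_add, Finset.range_one, Finset.sum_singleton, hsh, Equiv.Perm.sign_one,
    Units.val_one, one_smul, cylinder, Fin.sum_univ_succ, Fin.val_zero, pow_zero,
    Finset.univ_eq_empty, Finset.sum_empty, add_zero]
  congr 1
  funext i
  obtain rfl : i = 0 := Fin.ext (by omega)
  rw [cylinderSimplex_self]
  simp [pillars, pillarValue]

theorem shuffleSum_zero (f g : G →* H) (σ : BSimplex G 0) :
    shuffleSum f g 0 (Finsupp.single σ 1) = Finsupp.single (fun i => i.elim0) 1 := by
  have hsh : shuffles 0 0 = {1} := by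
    ext π
    simp [shuffles, Subsingleton.elim π 1]
  rw [shuffleSum_single]
  simp only [zero_add, Finset.range_one, Finset.sum_singleton, hsh, Equiv.Perm.sign_one,
    Units.val_one, one_smul]
  congr 1
  exact Subsingleton.elim _ _

/-- The family of morphisms of a chain homotopy with the given components of degree `1`. -/
def homotopyHom (s : ∀ n, Chains (BSimplex G n) →ₗ[ℤ] Chains (BSimplex H (n + 1))) (i j : ℕ) :
    (moore G).X i ⟶ (moore H).X j :=
  if hij : i + 1 = j then
    hij ▸ (ModuleCat.ofHom (s i) : (moore G).X i ⟶ (moore H).X (i + 1))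
  else 0

theorem homotopyHom_succ (s : ∀ n, Chains (BSimplex G n) →ₗ[ℤ] Chains (BSimplex H (n + 1)))
    (i : ℕ) : homotopyHom s i (i + 1) = ModuleCat.ofHom (s i) :=
  dif_pos rfl

/-- The chain homotopy between two edgewise subdivisions whose value in degree `0` is `c [ℓ]`. -/
def edgewiseHomotopy {f g h k : G →* H} {ℓ : H} (hfg : HomsCommute f g)
    (hhk : HomsCommute h k) (hℓ : ∀ x : G, ℓ * f x * g x = h x * k x * ℓ) (c : ℤ) :
    Homotopy (edgewiseMap f g hfg) (edgewiseMap h k hhk) where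
  hom := homotopyHom (scaledCylinder f g h k ℓ c)
  zero i j hij := dif_neg hij
  comm i := by
    rw [Homotopy.prevD_chainComplex]
    cases i with
    | zero =>
      rw [Homotopy.dNext_zero_chainComplex, moore_d_zero]
      have h0 : (edgewiseMap f g hfg).f 0 = (edgewiseMap h k hhk).f 0 := by
        refine congrArg ModuleCat.ofHom ?_
        rw [edgewise_eq_shuffleSum, edgewise_eq_shuffleSum]
        refine Finsupp.lhom_ext' fun σ => LinearMap.ext_ring ?_
        simp only [LinearMap.comp_apply, Finsupp.lsingle_apply, shuffleSum_zero]
      rw [h0, Limits.comp_zero, zero_add, zero_add]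
    | succ n =>
      rw [Homotopy.dNext_succ_chainComplex, moore_d, moore_d, homotopyHom_succ,
        homotopyHom_succ]
      have key := edgewiseCylinder_homotopy hfg hhk hℓ n
      rw [← scaledCylinder_comp_boundary f g h k ℓ c, ← scaledCylinder_succ f g h k ℓ c,
        ← edgewise_eq_shuffleSum, ← edgewise_eq_shuffleSum, eq_sub_iff_add_eq] at key
      refine (congrArg ModuleCat.ofHom key).symm.trans ?_
      rw [add_comm (boundary H (n + 1) ∘ₗ _)]
      rfl

theorem isCylindrical_edgewiseHomotopy {f g h k : G →* H} {ℓ : H} (hfg : HomsCommute f g)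
    (hhk : HomsCommute h k) (hℓ : ∀ x : G, ℓ * f x * g x = h x * k x * ℓ) (c : ℤ) :
    IsCylindrical f g h k ℓ c (edgewiseHomotopy hfg hhk hℓ c) := by
  have hom_eq : ∀ i, (edgewiseHomotopy hfg hhk hℓ c).hom i (i + 1) =
      ModuleCat.ofHom (scaledCylinder f g h k ℓ c i) := homotopyHom_succ _
  constructor
  · rw [hom_eq]
    change scaledCylinder f g h k ℓ c 0 _ = _
    rw [scaledCylinder, if_pos rfl, LinearMap.smul_apply, edgewiseCylinder_zero,
      Finsupp.smul_single, smul_eq_mul, mul_one]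
  · intro n hn
    obtain ⟨m, rfl⟩ := Nat.exists_eq_succ_of_ne_zero (Nat.one_le_iff_ne_zero.mp hn)
    rw [hom_eq, scaledCylinder_succ]

section DiameterFunction

variable {f g h k : G →* H} {ℓ : H} {c : ℤ} {E E' : moore G ⟶ moore H} {P : Homotopy E E'}

theorem IsCylindrical.diameter_zero (hP : IsCylindrical f g h k ℓ c P) (σ : BSimplex G 0) :
    diameter (X := BSimplex H (0 + 1))
      ((P.hom 0 (0 + 1)).hom (Finsupp.single σ 1 : Chains (BSimplex G 0))) = c.natAbs := by
  obtain rfl : σ = fun i => i.elim0 := Subsingleton.elim _ _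
  refine (congrArg (diameter (X := BSimplex H 1)) hP.1).trans (diameter_single _ _)

theorem IsCylindrical.diameter_eq (hP : IsCylindrical f g h k ℓ c P) {n : ℕ} (hn : 1 ≤ n)
    (σ : BSimplex G n) :
    diameter (X := BSimplex H (n + 1))
      ((P.hom n (n + 1)).hom (Finsupp.single σ 1 : Chains (BSimplex G n))) =
    diameter (edgewiseCylinder f g h k ℓ n (Finsupp.single σ 1)) := by
  rw [hP.2 n hn]
  rfl

theorem IsCylindrical.diameterFunction_zero (hP : IsCylindrical f g h k ℓ c P) :
    diameterFunction P 0 = c.natAbs := by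
  rw [diameterFunction]
  refine le_antisymm (iSup_le fun i => iSup_le fun hi => iSup_le fun σ => ?_) ?_
  · obtain rfl : i = 0 := Nat.le_zero.mp hi
    rw [hP.diameter_zero]
  · refine le_iSup_of_le 0 (le_iSup_of_le le_rfl (le_iSup_of_le (fun i => i.elim0) ?_))
    rw [hP.diameter_zero]

theorem IsCylindrical.diameter_le (hP : IsCylindrical f g h k ℓ c P) (hc : c.natAbs ≤ 1)
    (i : ℕ) (σ : BSimplex G i) :
    diameter (X := BSimplex H (i + 1))
      ((P.hom i (i + 1)).hom (Finsupp.single σ 1 : Chains (BSimplex G i))) ≤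
        2 ^ i * (i + 1) := by
  cases i with
  | zero => rw [hP.diameter_zero]; simpa using hc
  | succ i =>
    rw [hP.diameter_eq (Nat.succ_pos i)]
    exact diameter_edgewiseCylinder_le f g h k ℓ σ

/-- The bounds increase strictly with the dimension, so simplices of smaller dimension cannot reach
the bound in dimension `n`, although the supremum includes them. -/
theorem two_pow_mul_succ_strictMono : StrictMono fun n : ℕ => 2 ^ n * (n + 1) :=
  strictMono_nat_of_lt_succ fun n => by
    have : 0 < 2 ^ n := by positivity
    simp only [pow_succ]
    nlinarith

theorem IsCylindrical.diameterFunction_le (hP : IsCylindrical f g h k ℓ c P)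
    (hc : c.natAbs ≤ 1) (n : ℕ) : diameterFunction P n ≤ (2 ^ n * (n + 1) : ℕ) := by
  refine iSup_le fun i => iSup_le fun hi => iSup_le fun σ => ?_
  exact Nat.cast_le.mpr ((hP.diameter_le hc i σ).trans
    (two_pow_mul_succ_strictMono.monotone hi))

theorem IsCylindrical.diameterFunction_eq_iff (hP : IsCylindrical f g h k ℓ c P)
    (hc : c.natAbs ≤ 1) {n : ℕ} (hn : 1 ≤ n) :
    diameterFunction P n = (2 ^ n * (n + 1) : ℕ) ↔
      ∃ σ : BSimplex G n, NoCancellation f g h k ℓ σ := by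
  have hpos : 0 < 2 ^ n * (n + 1) := by positivity
  constructor
  · intro heq
    by_contra! hno
    -- Diameters are natural numbers, so missing the bound on every simplex means staying below it
    -- by at least one; this uniform gap passes to the supremum.
    have hle : diameterFunction P n ≤ (2 ^ n * (n + 1) - 1 : ℕ) := by
      refine iSup_le fun i => iSup_le fun hi => iSup_le fun σ => Nat.cast_le.mpr ?_
      have hbound := hP.diameter_le hc i σ
      rcases hi.lt_or_eq with hlt | rfl
      · have := two_pow_mul_succ_strictMono hlt
        simp only at this
        omega
      · have hne : diameter (X := BSimplex H (i + 1))
            ((P.hom i (i + 1)).hom (Finsupp.single σ 1 : Chains (BSimplex G i))) ≠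
              2 ^ i * (i + 1) := by
          rw [hP.diameter_eq hn, Ne, diameter_edgewiseCylinder_eq_iff]
          exact hno σ
        omega
    rw [heq, Nat.cast_le] at hle
    omega
  · rintro ⟨σ, hσ⟩
    refine le_antisymm (hP.diameterFunction_le hc n) ?_
    refine le_iSup_of_le n (le_iSup_of_le le_rfl (le_iSup_of_le σ ?_))
    rw [hP.diameter_eq hn, (diameter_edgewiseCylinder_eq_iff f g h k ℓ σ).mpr hσ]

theorem IsCylindrical.diameterFunction_eq (hP : IsCylindrical f g h k ℓ c P)
    (hc : c.natAbs ≤ 1) {n : ℕ} (hn : 1 ≤ n) {x : G} (hfg : f x ≠ g x) (hhk : h x ≠ k x)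
    (hm : ∀ j : ℕ, j ≤ n →
      pillarValue f h ℓ (x ^ j) ≠ h x ∧ pillarValue f h ℓ (x ^ j) ≠ k x) :
    diameterFunction P n = (2 ^ n * (n + 1) : ℕ) :=
  (hP.diameterFunction_eq_iff hc hn).mpr ⟨_, noCancellation_const hfg hhk hm⟩

end DiameterFunction

end ChainComplexes

end EdgewiseHomotopy

end

/-! ### The theorem, with an example over the integers attaining the bound. -/

open EdgewiseHomotopy in
theorem theorem4p4 :
    (∀ (G H : Type u) [Group G] [Group H] (f g h k : G →* H) (ℓ : H),
      HomsCommute f g → HomsCommute h k → (∀ x : G, ℓ * f x * g x = h x * k x * ℓ) →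
      ∃ E E' : moore G ⟶ moore H, IsEdgewise f g E ∧ IsEdgewise h k E' ∧
        (∀ (n : ℕ) (σ : BSimplex G n),
          edgewise f g n (Finsupp.single σ 1) =
              ∑ p ∈ Finset.range (n + 1), ∑ π ∈ shuffles n p,
                (Equiv.Perm.sign π : ℤ) • Finsupp.single (shuffleSimplex f g p π σ) (1 : ℤ) ∧
          edgewise h k n (Finsupp.single σ 1) =
              ∑ p ∈ Finset.range (n + 1), ∑ π ∈ shuffles n p,
                (Equiv.Perm.sign π : ℤ) • Finsupp.single (shuffleSimplex h k p π σ) (1 : ℤ) ∧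
          ∀ p ∈ Finset.range (n + 1), ∀ π ∈ shuffles n p,
            IsPillars (shuffleSimplex f g p π σ) (shuffleSimplex h k p π σ)
              (pillars f h ℓ p π σ)) ∧
        (∀ n : ℕ, ∑ p ∈ Finset.range (n + 1), ∑ _π ∈ shuffles n p, (n + 1) = 2 ^ n * (n + 1)) ∧
        ∀ c : ℤ, c = 0 ∨ c = 1 →
          ∃ P : Homotopy E E', IsCylindrical f g h k ℓ c P ∧
            diameterFunction P 0 = c.natAbs ∧
            ∀ n : ℕ, 1 ≤ n →
              diameterFunction P n ≤ (2 ^ n * (n + 1) : ℕ) ∧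
              (diameterFunction P n = (2 ^ n * (n + 1) : ℕ) ↔
                ∃ σ : BSimplex G n, NoCancellation f g h k ℓ σ) ∧
              (∀ x : G, f x ≠ g x → h x ≠ k x →
                (∀ j : ℕ, j ≤ n →
                  pillarValue f h ℓ (x ^ j) ≠ h x ∧ pillarValue f h ℓ (x ^ j) ≠ k x) →
                diameterFunction P n = (2 ^ n * (n + 1) : ℕ))) ∧
    (∃ (G H : Type u) (_ : Group G) (_ : Group H) (f g h k : G →* H) (ℓ : H),
      HomsCommute f g ∧ HomsCommute h k ∧ (∀ x : G, ℓ * f x * g x = h x * k x * ℓ) ∧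
      ∀ E E' : moore G ⟶ moore H, IsEdgewise f g E → IsEdgewise h k E' →
        ∀ (c : ℤ) (P : Homotopy E E'), c = 0 ∨ c = 1 → IsCylindrical f g h k ℓ c P →
          ∀ n : ℕ, 1 ≤ n → diameterFunction P n = (2 ^ n * (n + 1) : ℕ)) := by
  have hc : ∀ c : ℤ, c = 0 ∨ c = 1 → c.natAbs ≤ 1 := by
    rintro c (rfl | rfl) <;> simp
  refine ⟨?_, ?_⟩
  · intro G H _ _ f g h k ℓ hfg hhk hℓ
    refine ⟨edgewiseMap f g hfg, edgewiseMap h k hhk, isEdgewise_edgewiseMap f g hfg,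
      isEdgewise_edgewiseMap h k hhk, fun n σ => ⟨edgewise_single f g σ, edgewise_single h k σ,
        fun p hp π hπ => isPillars_shuffle hfg hhk hℓ ?_ hπ σ⟩, sum_shuffles_const,
      fun c hc' => ?_⟩
    · rw [Finset.mem_range] at hp
      omega
    · have hP := isCylindrical_edgewiseHomotopy hfg hhk hℓ c
      exact ⟨edgewiseHomotopy hfg hhk hℓ c, hP, hP.diameterFunction_zero, fun n hn =>
        ⟨hP.diameterFunction_le (hc c hc') n, hP.diameterFunction_eq_iff (hc c hc') hn,
          fun x hx hx' hm => hP.diameterFunction_eq (hc c hc') hn hx hx' hm⟩⟩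
  · let Z := ULift.{u} (Multiplicative ℤ)
    let z : ℤ → Z := fun m => ULift.up (Multiplicative.ofAdd m)
    have hz : ∀ a b : ℤ, a ≠ b → z a ≠ z b := fun a b hab h' => hab (by
      have := congrArg (fun y : Z => Multiplicative.toAdd y.down) h'
      simpa [z] using this)
    refine ⟨Z, Z, inferInstance, inferInstance, 1, MonoidHom.id Z, 1, MonoidHom.id Z, z 2,
      fun x y => mul_comm _ _, fun x y => mul_comm _ _, fun x => ?_, ?_⟩
    · simp [mul_comm]
    · intro E E' _ _ c P hc' hP n hn
      refine hP.diameterFunction_eq (hc c hc') hn (x := z 1) ?_ ?_ fun j _ => ?_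
      · exact hz 0 1 (by norm_num)
      · exact hz 0 1 (by norm_num)
      · have : pillarValue (1 : Z →* Z) 1 (z 2) (z 1 ^ j) = z 2 := by simp [pillarValue]
        rw [this]
        exact ⟨hz 2 0 (by norm_num), hz 2 1 (by norm_num)⟩
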